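/- Let $n\ge 0$, let $\eta_1,\dots,\eta_n$ be points of the unit circle $\mathbb T$ and let $q_1,\dots,q_n$ be real numbers. Put $$|R(z)|=\prod_{j=1}^n|z-\eta_j|^{q_j},\qquad \gamma(z)=\sum_{j=1}^n|q_j|\,|z-\eta_j|^{-1},\qquad |\tilde R(z)|=\prod_{j=1}^n|z-\eta_j|^{(q_j)_+},$$ where $(q)_+=\max(q,0)$. For a holomorphic function $f$ in the unit disc $\mathbb D$ and $0<\delta<1$ set $$\|f\|_{\mathcal N_{|R|,0}}=\sup_{1-\delta<s<1}\int_0^{2\pi}|R(se^{i\theta})|\log^+|f(se^{i\theta})|\,d\theta+\sup_{1-\delta<s<1}\int_{\mathbb D}\gamma(sz)\,|R(sz)|\log^+|f(sz)|\,dm(z)\in[0,\infty],$$ where $m$ is Lebesgue measure in the plane, and say that $f\in\mathcal N_{|R|,0}(\mathbb D)$ if this is finite for some $\delta\in(0,1)$. Then there is a constant $c(R)>0$, depending only on $n$, the $\eta_j$ and the $q_j$, such that every $f\in\mathcal N_{|R|,0}(\mathbb D)$ with $|f(0)|=1$ satisfies $$\sum_{a\in Z(f)}(1-|a|^2)\,|\tilde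 R(a)|\le c(R)\,\|f\|_{\mathcal N_{|R|,0}}$$ for every $\delta\in(0,1)$ for which $\|f\|_{\mathcal N_{|R|,0}}$ is finite. Here $Z(f)$ is the zero set of $f$ in $\mathbb D$, each zero being repeated according to its multiplicity. -/

import Mathlib

open scoped ENNReal NNReal

noncomputable section

namespace NevanlinnaDisc

/-- The modulus `|R(z)| = ∏ⱼ |z - ηⱼ| ^ qⱼ` of `R(z) = ∏ⱼ (z - ηⱼ) ^ qⱼ`, with real exponents `qⱼ`.
It does not depend on the branch of the powers. -/
def absR {n : ℕ} (η : Fin n → ℂ) (q : Fin n → ℝ) (z : ℂ) : ℝ :=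
  ∏ j, ‖z - η j‖ ^ q j

/-- `γ(z) = ∑ⱼ |qⱼ| |z - ηⱼ|⁻¹`. -/
def gammaWeight {n : ℕ} (η : Fin n → ℂ) (q : Fin n → ℝ) (z : ℂ) : ℝ :=
  ∑ j, |q j| * ‖z - η j‖⁻¹

/-- The quantity `‖f‖` of the class `N_{|R|,0}`, computed with the parameter `δ`:
`sup_{1-δ<s<1} ∫_𝕋 |R(s e^{iθ})| log⁺|f(s e^{iθ})| dθ
  + sup_{1-δ<s<1} ∫_𝔻 γ(sz) |R(sz)| log⁺|f(sz)| dm(z)`, with values in `[0, ∞]`. -/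
def nevanlinnaNorm {n : ℕ} (η : Fin n → ℂ) (q : Fin n → ℝ) (δ : ℝ) (f : ℂ → ℂ) : ℝ≥0∞ :=
  (⨆ s ∈ Set.Ioo (1 - δ) 1, ∫⁻ θ in Set.Ioc (0 : ℝ) (2 * Real.pi),
      ENNReal.ofReal (absR η q (s * Complex.exp (θ * Complex.I)) *
        Real.posLog ‖f (s * Complex.exp (θ * Complex.I))‖)) +
  (⨆ s ∈ Set.Ioo (1 - δ) 1, ∫⁻ z in Metric.ball (0 : ℂ) 1,
      ENNReal.ofReal (gammaWeight η q (s * z) * absR η q (s * z) *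
        Real.posLog ‖f (s * z)‖))

/-- The generalised Nevanlinna class `N_{|R|,0}(𝔻)`: the functions holomorphic in the unit disc
for which the quantity above is finite for some `0 < δ < 1`. -/
def MemNevanlinna {n : ℕ} (η : Fin n → ℂ) (q : Fin n → ℝ) (f : ℂ → ℂ) : Prop :=
  DifferentiableOn ℂ f (Metric.ball 0 1) ∧
    ∃ δ ∈ Set.Ioo (0 : ℝ) 1, nevanlinnaNorm η q δ f < ∞

/-- The zero set of `f` in the open unit disc. -/
def zeroSet (f : ℂ → ℂ) : Set ℂ := {a | a ∈ Metric.ball (0 : ℂ) 1 ∧ f a = 0}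

/-- `∑_{a ∈ Z(f)} (1 - |a|²) w(a)`, zeros counted with multiplicity, with values in `[0, ∞]`. -/
def blaschkeSum (w : ℂ → ℝ) (f : ℂ → ℂ) : ℝ≥0∞ :=
  ∑' a : zeroSet f, (analyticOrderNatAt f (a : ℂ) : ℝ≥0∞) *
    ENNReal.ofReal ((1 - ‖(a : ℂ)‖ ^ 2) * w a)

end NevanlinnaDisc

end

open MeasureTheory Metric

namespace NevanlinnaDisc

/-! Fix finitely many zeros and test `log |f|` against the Laplacian of a compactly supported `G ≥
0`. The choice is `G(z) = χ(1 - |z|²) |R̃(z)| exp(α (1 - |z|²))`, where `χ` is a smooth convex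
substitute for the identity that vanishes near `0` (`cutoff`). Once its scale `τ` is small, `2 G(a)`
dominates `(1 - |a|²) |R̃(a)|` at each chosen zero. A Green inequality
(`sum_order_mul_le_integral_laplacian`) bounds `∑ m(a) G(a)` by a multiple of `∫ log |f| ΔG`. It
follows from Jensen's inequality on circles of radius `ε → 0`, so the distributional Laplacian of
`log |f|` is never needed. The constant is `π log 2` instead of the sharp `2π`, which is harmless.

The integral is split by the sign of `log |f|`. Where `log |f| ≥ 0`, an upper bound on `ΔG` is
needed: `laplacian_testFn_le` gives a multiple of `χ''(1 - |z|²) |R| + γ |R|`. The first term lives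
on a thin annulus with bounded total radial mass, so the circle part of the norm controls it; the
second is the area part.

Where `log |f| ≤ 0`, a lower bound is needed. For `α` large `ΔG ≥ 0` outside `|z| < 3/4`, and inside
it is bounded below (`neg_laplacian_testFn_le`). Since `|f(0)| = 1`, Jensen bounds the mass of the
negative part of `log |f|` on that disc by the mass of the positive part, which the area term
controls because `γ |R|` is bounded below there.

This last step, and the absorption of constants into `γ`, need some `q_j ≠ 0`. If all exponents
vanish then `γ = 0` and `|R| = 1`, and Jensen's formula on circles near the boundary gives the
claim. All bounds are uniform in `τ` and in the finite set of zeros. -/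

variable {n : ℕ}

/-! ### Jensen's inequality and the negative part of `log |f|` on circles -/

/-- Jensen's formula as an inequality: any finite family of points contributes at most the
difference between the circle mean and the value at the centre. -/
lemma sum_order_mul_posLog_le {f : ℂ → ℂ} {c : ℂ} {R : ℝ} (hR : 0 < R)
    (hf : AnalyticOnNhd ℂ f (closedBall c R)) (hc : f c ≠ 0) (S : Finset ℂ) :
    ∑ a ∈ S, (analyticOrderNatAt f a : ℝ) * Real.posLog (R / ‖c - a‖) ≤
      Real.circleAverage (fun z => Real.log ‖f z‖) c R - Real.log ‖f c‖ := by
  have hf' : AnalyticOnNhd ℂ f (closedBall c |R|) := by rwa [abs_of_pos hR]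
  rw [hf'.circleAverage_log_norm hR.ne' hc, add_sub_cancel_right]
  set D := MeromorphicOn.divisor f (closedBall c |R|) with hD
  have hfin := D.finiteSupport (isCompact_closedBall c |R|)
  have hsub : Function.support (fun u => (D u : ℝ) * Real.log (R * ‖c - u‖⁻¹)) ⊆
      ((hfin.toFinset ∪ S : Finset ℂ) : Set ℂ) := by
    intro u hu
    simp only [Function.mem_support, ne_eq, mul_eq_zero, not_or, Int.cast_eq_zero] at hu
    simp [hu.1]
  have hin : ∀ u ∈ closedBall c R, (D u : ℝ) = analyticOrderNatAt f u ∧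
      0 ≤ Real.log (R * ‖c - u‖⁻¹) := by
    intro u hu
    have hu' : u ∈ closedBall c |R| := by rwa [abs_of_pos hR]
    refine ⟨?_, ?_⟩
    · rw [hD, MeromorphicOn.AnalyticOnNhd.divisor_apply hf' hu']
      rw [analyticOrderNatAt]
      cases h : analyticOrderAt f u <;> simp
    -- At the centre the conventions `0⁻¹ = 0` and `log 0 = 0` make the logarithm vanish.
    · by_cases hcu : c = u
      · simp [hcu]
      · rw [mem_closedBall, dist_comm, dist_eq_norm] at hu
        have : 0 < ‖c - u‖ := norm_pos_iff.2 (sub_ne_zero.2 hcu)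
        apply Real.log_nonneg
        rw [← div_eq_mul_inv, le_div_iff₀ this]
        linarith
  have hout : ∀ u, u ∉ closedBall c R → (D u : ℝ) = 0 ∧ Real.posLog (R / ‖c - u‖) = 0 := by
    intro u hu
    have hu' : u ∉ closedBall c |R| := by rwa [abs_of_pos hR]
    refine ⟨by simp [hD, hu'], ?_⟩
    rw [mem_closedBall, dist_comm, dist_eq_norm, not_le] at hu
    rw [Real.posLog_eq_zero_iff, abs_of_nonneg (by positivity), div_le_one (by linarith)]
    exact hu.le
  rw [finsum_eq_sum_of_support_subset _ hsub]
  refine (Finset.sum_le_sum fun a _ => ?_).trans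
    (Finset.sum_le_sum_of_subset_of_nonneg Finset.subset_union_right fun u _ _ => ?_)
  · by_cases ha : a ∈ closedBall c R
    · obtain ⟨h1, h2⟩ := hin a ha
      rw [h1, ← div_eq_mul_inv] at *
      rw [Real.posLog, max_eq_right h2]
    · obtain ⟨h1, h2⟩ := hout a ha
      rw [h1, h2]; simp
  · by_cases ha : u ∈ closedBall c R
    · obtain ⟨h1, h2⟩ := hin u ha
      rw [h1]; positivity
    · rw [(hout u ha).1]; simp

lemma log_norm_le_circleAverage {f : ℂ → ℂ} {c : ℂ} {R : ℝ} (hR : 0 < R)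
    (hf : AnalyticOnNhd ℂ f (closedBall c R)) (hc : f c ≠ 0) :
    Real.log ‖f c‖ ≤ Real.circleAverage (fun z => Real.log ‖f z‖) c R := by
  simpa using sum_order_mul_posLog_le hR hf hc ∅

lemma analyticOnNhd_closedBall {f : ℂ → ℂ} (hf : DifferentiableOn ℂ f (ball 0 1)) {c : ℂ} {R : ℝ}
    (h : ‖c‖ + R < 1) : AnalyticOnNhd ℂ f (closedBall c R) := by
  refine (hf.analyticOnNhd isOpen_ball).mono fun z hz => ?_
  rw [mem_closedBall, dist_eq_norm] at hz
  rw [mem_ball_zero_iff]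
  have := norm_add_le c (z - c)
  rw [add_sub_cancel] at this
  linarith

/-- On each circle about the origin the negative part of `log |f|` has at most the mass of the
positive part. -/
lemma lintegral_negPart_circle_le {f : ℂ → ℂ} (hf : DifferentiableOn ℂ f (ball 0 1))
    (h0 : ‖f 0‖ = 1) {r : ℝ} (hr : 0 < r) (hr1 : r < 1) :
    ∫⁻ θ in Set.Ioo (-Real.pi) Real.pi, ENNReal.ofReal (-Real.log ‖f (circleMap 0 r θ)‖) ≤
      ∫⁻ θ in Set.Ioo (-Real.pi) Real.pi, ENNReal.ofReal (Real.log ‖f (circleMap 0 r θ)‖) := by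
  have hA := analyticOnNhd_closedBall hf (c := 0) (R := r) (by simpa using hr1)
  have hc : f 0 ≠ 0 := by rw [← norm_pos_iff, h0]; exact one_pos
  have h1 := log_norm_le_circleAverage hr hA hc
  -- The period is started at `-π` to match the angular range of polar coordinates.
  rw [h0, Real.log_one, Real.circleAverage_eq_integral_add (-Real.pi)] at h1
  have hci : CircleIntegrable (fun z => Real.log ‖f z‖) 0 r := by
    apply MeromorphicOn.circleIntegrable_log_norm
    rw [abs_of_pos hr]
    exact (hA.mono sphere_subset_closedBall).meromorphicOn
  have hper : Function.Periodic (fun θ => Real.log ‖f (circleMap 0 r θ)‖) (2 * Real.pi) := by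
    intro θ; simp [periodic_circleMap 0 r θ]
  have hint : IntegrableOn (fun θ => Real.log ‖f (circleMap 0 r θ)‖)
      (Set.Ioo (-Real.pi) Real.pi) := by
    have h2 := hper.intervalIntegrable₀ (by positivity) hci (-Real.pi) Real.pi
    rw [intervalIntegrable_iff_integrableOn_Ioo_of_le (by linarith [Real.pi_pos])] at h2
    exact h2
  have h3 : 0 ≤ ∫ θ in Set.Ioo (-Real.pi) Real.pi, Real.log ‖f (circleMap 0 r θ)‖ := by
    have h4 : ∫ θ in (0 : ℝ)..2 * Real.pi, Real.log ‖f (circleMap 0 r (θ + -Real.pi))‖ =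
        ∫ θ in Set.Ioo (-Real.pi) Real.pi, Real.log ‖f (circleMap 0 r θ)‖ := by
      rw [intervalIntegral.integral_comp_add_right
        (fun θ => Real.log ‖f (circleMap 0 r θ)‖),
        intervalIntegral.integral_of_le (by linarith [Real.pi_pos]), integral_Ioc_eq_integral_Ioo]
      congr 3 <;> ring
    rw [← h4]
    rw [smul_eq_mul] at h1
    exact nonneg_of_mul_nonneg_right h1 (by positivity)
  rw [integral_eq_lintegral_pos_part_sub_lintegral_neg_part hint, sub_nonneg] at h3
  refine (ENNReal.toReal_le_toReal ?_ ?_).1 h3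
  · refine ne_top_of_le_ne_top hint.neg.2.ne (lintegral_mono fun θ => ?_)
    exact Real.ofReal_le_enorm _
  · refine ne_top_of_le_ne_top hint.2.ne (lintegral_mono fun θ => ?_)
    exact Real.ofReal_le_enorm _

/-! ### Polar coordinates and local integrability of `log |f|` -/

/-- Integration in polar coordinates over a disc about the origin. -/
lemma lintegral_ball_eq_polar {ρ : ℝ} (g : ℂ → ℝ≥0∞) :
    ∫⁻ z in ball (0 : ℂ) ρ, g z = ∫⁻ p in Set.Ioo 0 ρ ×ˢ Set.Ioo (-Real.pi) Real.pi,
      ENNReal.ofReal p.1 * g (circleMap 0 p.1 p.2) := by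
  rw [← lintegral_indicator measurableSet_ball, ← Complex.lintegral_comp_polarCoord_symm,
    ← lintegral_indicator polarCoord.open_target.measurableSet,
    ← lintegral_indicator (measurableSet_Ioo.prod measurableSet_Ioo)]
  congr 1
  ext ⟨r, θ⟩
  have hsymm : (Complex.polarCoord.symm (r, θ) : ℂ) = circleMap 0 r θ := by
    rw [Complex.polarCoord_symm_apply, circleMap, zero_add, Complex.exp_mul_I]
    push_cast
    ring_nf
  by_cases h : (r, θ) ∈ polarCoord.target
  · rw [Set.indicator_of_mem h, hsymm]
    simp only [polarCoord_target, Set.mem_prod, Set.mem_Ioi] at h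
    by_cases hr : r < ρ
    · rw [Set.indicator_of_mem (by simp [abs_of_pos h.1, hr]),
        Set.indicator_of_mem (show (r, θ) ∈ Set.Ioo 0 ρ ×ˢ Set.Ioo (-Real.pi) Real.pi from
          ⟨⟨h.1, hr⟩, h.2⟩)]
      simp
    · rw [Set.indicator_of_notMem (by simpa [abs_of_pos h.1] using hr),
        Set.indicator_of_notMem (fun h' => hr h'.1.2)]
      simp
  · rw [Set.indicator_of_notMem h, Set.indicator_of_notMem]
    simp only [polarCoord_target, Set.mem_prod, Set.mem_Ioi] at h
    exact fun h' => h ⟨h'.1.1, h'.2⟩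

lemma measurable_circleMap_uncurry : Measurable fun p : ℝ × ℝ => circleMap 0 p.1 p.2 := by
  apply Continuous.measurable
  unfold circleMap
  fun_prop

lemma lintegral_ball_eq_iterated {ρ : ℝ} {g : ℂ → ℝ≥0∞} (hg : Measurable g) :
    ∫⁻ z in ball (0 : ℂ) ρ, g z = ∫⁻ r in Set.Ioo 0 ρ, ENNReal.ofReal r *
      ∫⁻ θ in Set.Ioo (-Real.pi) Real.pi, g (circleMap 0 r θ) := by
  have hm : Measurable fun p : ℝ × ℝ => ENNReal.ofReal p.1 * g (circleMap 0 p.1 p.2) :=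
    (ENNReal.measurable_ofReal.comp measurable_fst).mul (hg.comp measurable_circleMap_uncurry)
  rw [lintegral_ball_eq_polar, Measure.volume_eq_prod, ← Measure.prod_restrict,
    lintegral_prod _ hm.aemeasurable]
  refine lintegral_congr fun r => ?_
  have h : Measurable fun θ => g (circleMap 0 r θ) :=
    hg.comp (measurable_circleMap_uncurry.comp measurable_prodMk_left)
  exact lintegral_const_mul (ENNReal.ofReal r) h

/-- Nothing is known about `f` off the disc; its extension by zero is a globally measurable
representative, as Tonelli in polar coordinates requires. -/
lemma measurable_indicator_ball {f : ℂ → ℂ} (hf : DifferentiableOn ℂ f (ball 0 1)) :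
    Measurable ((ball (0 : ℂ) 1).indicator f) := by
  classical
  have := ContinuousOn.measurable_piecewise (s := ball (0 : ℂ) 1) (f := f) (g := fun _ => 0)
    hf.continuousOn continuousOn_const measurableSet_ball
  rw [← Set.piecewise_eq_indicator]
  exact this

lemma lintegral_negPart_ball_le {f : ℂ → ℂ} (hf : DifferentiableOn ℂ f (ball 0 1))
    (h0 : ‖f 0‖ = 1) {ρ : ℝ} (hρ : ρ ≤ 1) :
    ∫⁻ z in ball (0 : ℂ) ρ, ENNReal.ofReal (-Real.log ‖f z‖) ≤
      ∫⁻ z in ball (0 : ℂ) ρ, ENNReal.ofReal (Real.log ‖f z‖) := by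
  set F := (ball (0 : ℂ) 1).indicator f with hF
  have hFm : Measurable fun z => Real.log ‖F z‖ :=
    Real.measurable_log.comp (measurable_indicator_ball hf).norm
  have hFf : ∀ z ∈ ball (0 : ℂ) 1, F z = f z := fun z hz => Set.indicator_of_mem hz f
  have e1 : ∫⁻ z in ball (0 : ℂ) ρ, ENNReal.ofReal (-Real.log ‖f z‖) =
      ∫⁻ z in ball (0 : ℂ) ρ, ENNReal.ofReal (-Real.log ‖F z‖) :=
    setLIntegral_congr_fun measurableSet_ball fun z hz => by
      simp only [hFf z (ball_subset_ball hρ hz)]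
  have e2 : ∫⁻ z in ball (0 : ℂ) ρ, ENNReal.ofReal (Real.log ‖f z‖) =
      ∫⁻ z in ball (0 : ℂ) ρ, ENNReal.ofReal (Real.log ‖F z‖) :=
    setLIntegral_congr_fun measurableSet_ball fun z hz => by
      simp only [hFf z (ball_subset_ball hρ hz)]
  have hFn : Measurable fun z => ENNReal.ofReal (-Real.log ‖F z‖) := hFm.neg.ennreal_ofReal
  rw [e1, e2, lintegral_ball_eq_iterated hFn,
    lintegral_ball_eq_iterated hFm.ennreal_ofReal]
  refine setLIntegral_mono' measurableSet_Ioo fun r hr => ?_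
  gcongr ENNReal.ofReal r * ?_
  have hc : ∀ θ, F (circleMap 0 r θ) = f (circleMap 0 r θ) := fun θ =>
    hFf _ (by simpa [abs_of_pos hr.1] using hr.2.trans_le hρ)
  simp only [hc]
  exact lintegral_negPart_circle_le hf h0 hr.1 (hr.2.trans_le hρ)

/-- The positive part is bounded on a compact disc by continuity, and the normalisation at the
origin makes the negative part no larger in mass. -/
lemma integrableOn_log_norm {f : ℂ → ℂ} (hf : DifferentiableOn ℂ f (ball 0 1))
    (h0 : ‖f 0‖ = 1) {ρ : ℝ} (hρ : ρ < 1) :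
    IntegrableOn (fun z => Real.log ‖f z‖) (ball 0 ρ) := by
  have hsub : closedBall (0 : ℂ) ρ ⊆ ball 0 1 := closedBall_subset_ball hρ
  have hcont : ContinuousOn (fun z => Real.posLog ‖f z‖) (closedBall 0 ρ) :=
    Real.continuous_posLog.comp_continuousOn (hf.continuousOn.mono hsub).norm
  have hpos : IntegrableOn (fun z => Real.posLog ‖f z‖) (ball 0 ρ) :=
    (hcont.integrableOn_compact (isCompact_closedBall 0 ρ)).mono_set ball_subset_closedBall
  have hfin : ∫⁻ z in ball (0 : ℂ) ρ, ENNReal.ofReal (Real.log ‖f z‖) < ∞ := by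
    refine lt_of_le_of_lt (lintegral_mono fun z => ?_) hpos.2
    refine le_trans (ENNReal.ofReal_le_ofReal ?_) (Real.ofReal_le_enorm _)
    exact le_max_right _ _
  have hneg := (lintegral_negPart_ball_le hf h0 hρ.le).trans_lt hfin
  have hm : AEStronglyMeasurable (fun z => Real.log ‖f z‖) (volume.restrict (ball 0 ρ)) := by
    have hfm : AEMeasurable f (volume.restrict (ball 0 ρ)) :=
      (hf.continuousOn.mono (ball_subset_closedBall.trans hsub)).aemeasurable measurableSet_ball
    exact (Real.measurable_log.comp_aemeasurable hfm.norm).aestronglyMeasurable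
  refine ⟨hm, ?_⟩
  have : ∀ x : ℝ, ‖x‖ₑ ≤ ENNReal.ofReal x + ENNReal.ofReal (-x) := by
    intro x
    rw [Real.enorm_eq_ofReal_abs]
    rcases le_total 0 x with h | h
    · rw [abs_of_nonneg h]; exact le_self_add
    · rw [abs_of_nonpos h]; exact le_add_self
  refine lt_of_le_of_lt (lintegral_mono fun z => this _) ?_
  rw [lintegral_add_left' hm.aemeasurable.ennreal_ofReal]
  exact ENNReal.add_lt_top.2 ⟨hfin, hneg⟩

/-! ### Taylor expansion and circle means of smooth functions -/

open Laplacian in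
lemma laplacian_eq_fderiv_fderiv (G : ℂ → ℝ) (z : ℂ) :
    Δ G z = fderiv ℝ (fderiv ℝ G) z 1 1 + fderiv ℝ (fderiv ℝ G) z Complex.I Complex.I := by
  rw [InnerProductSpace.laplacian_eq_iteratedFDeriv_complexPlane]
  simp [iteratedFDeriv_two_apply]

lemma hasDerivAt_comp_line {E : Type*} [NormedAddCommGroup E] [NormedSpace ℝ E] {G : ℂ → E}
    (hG : Differentiable ℝ G) (z v : ℂ) (s : ℝ) :
    HasDerivAt (fun s : ℝ => G (z + s * v)) (fderiv ℝ G (z + s * v) v) s := by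
  have h1 : HasDerivAt (fun s : ℝ => z + s * v) v s := by
    simpa using ((hasDerivAt_id s).ofReal_comp.mul_const v).const_add z
  exact (hG (z + s * v)).hasFDerivAt.comp_hasDerivAt s h1

/-- The mean value inequality is applied twice to `g` minus its quadratic Taylor polynomial; losing
the factor `1/2` is harmless. -/
lemma abs_taylor_two_le {g g' g'' : ℝ → ℝ} (h1 : ∀ s, HasDerivAt g (g' s) s)
    (h2 : ∀ s, HasDerivAt g' (g'' s) s) {M : ℝ} (hM : 0 ≤ M)
    (hb : ∀ s ∈ Set.Icc (0 : ℝ) 1, |g'' s - g'' 0| ≤ M) :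
    |g 1 - g 0 - g' 0 - g'' 0 / 2| ≤ M := by
  have d1 : ∀ s, HasDerivAt (fun s => g s - s * g' 0 - s ^ 2 / 2 * g'' 0)
      (g' s - g' 0 - s * g'' 0) s := by
    intro s
    refine (((h1 s).sub ((hasDerivAt_id s).mul_const (g' 0))).sub
      ((((hasDerivAt_id s).pow 2).div_const 2).mul_const (g'' 0))).congr_deriv ?_
    simp
  have d2 : ∀ s, HasDerivAt (fun s => g' s - g' 0 - s * g'' 0) (g'' s - g'' 0) s := by
    intro s
    refine (((h2 s).sub_const (g' 0)).sub
      ((hasDerivAt_id s).mul_const (g'' 0))).congr_deriv ?_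
    simp
  have b1 : ∀ s ∈ Set.Icc (0 : ℝ) 1, ‖g' s - g' 0 - s * g'' 0‖ ≤ M := by
    intro s hs
    have := (convex_Icc (0 : ℝ) 1).norm_image_sub_le_of_norm_hasDerivWithin_le
      (fun x _ => (d2 x).hasDerivWithinAt) hb (Set.left_mem_Icc.2 zero_le_one) hs
    simp only [sub_zero, sub_self, zero_mul, Real.norm_of_nonneg hs.1] at this
    exact this.trans (mul_le_of_le_one_right hM hs.2)
  have := (convex_Icc (0 : ℝ) 1).norm_image_sub_le_of_norm_hasDerivWithin_le
    (fun x _ => (d1 x).hasDerivWithinAt) b1 (Set.left_mem_Icc.2 zero_le_one)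
    (Set.right_mem_Icc.2 zero_le_one)
  rw [sub_zero, norm_one, mul_one, Real.norm_eq_abs] at this
  convert this using 2
  ring

lemma exists_lipschitzWith_fderiv_fderiv {G : ℂ → ℝ} (hG : ContDiff ℝ 3 G) (hc : HasCompactSupport G) :
    ∃ C, LipschitzWith C (fderiv ℝ (fderiv ℝ G)) := by
  have h1 : ContDiff ℝ 2 (fderiv ℝ G) := hG.fderiv_right (by norm_num)
  have h2 : ContDiff ℝ 1 (fderiv ℝ (fderiv ℝ G)) := h1.fderiv_right (by norm_num)
  exact h2.lipschitzWith_of_hasCompactSupport ((hc.fderiv ℝ).fderiv ℝ) one_ne_zero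

lemma abs_fderiv_fderiv_line_sub_le {G : ℂ → ℝ} {C : ℝ≥0} (hC : LipschitzWith C (fderiv ℝ (fderiv ℝ G)))
    (z v : ℂ) :
    ∀ s ∈ Set.Icc (0 : ℝ) 1, |fderiv ℝ (fderiv ℝ G) (z + s * v) v v
      - fderiv ℝ (fderiv ℝ G) (z + (0 : ℝ) * v) v v| ≤ C * ‖v‖ ^ 3 := by
    intro s hs
    have h3 : |fderiv ℝ (fderiv ℝ G) (z + s * v) v v - fderiv ℝ (fderiv ℝ G) z v v| ≤
        ‖fderiv ℝ (fderiv ℝ G) (z + s * v) - fderiv ℝ (fderiv ℝ G) z‖ * ‖v‖ * ‖v‖ :=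
      (fderiv ℝ (fderiv ℝ G) (z + s * v) - fderiv ℝ (fderiv ℝ G) z).le_opNorm₂ v v
    have h4 := hC.norm_sub_le (z + s * v) z
    rw [add_sub_cancel_left, norm_mul, Complex.norm_real, Real.norm_of_nonneg hs.1] at h4
    have h5 : (C : ℝ) * (s * ‖v‖) ≤ C * ‖v‖ := by
      gcongr; exact mul_le_of_le_one_left (norm_nonneg v) hs.2
    rw [Complex.ofReal_zero, zero_mul, add_zero]
    refine h3.trans ?_
    calc _ ≤ C * ‖v‖ * ‖v‖ * ‖v‖ := by gcongr; exact h4.trans h5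
      _ = C * ‖v‖ ^ 3 := by ring

lemma hasDerivAt_fderiv_line {G : ℂ → ℝ} (hG : ContDiff ℝ 3 G) (z v : ℂ) :
    ∀ s : ℝ, HasDerivAt (fun s : ℝ => fderiv ℝ G (z + s * v) v)
      (fderiv ℝ (fderiv ℝ G) (z + s * v) v v) s := by
    have h1 : ContDiff ℝ 2 (fderiv ℝ G) := hG.fderiv_right (by norm_num)
    intro s
    have h := (hasDerivAt_comp_line (h1.differentiable (by norm_num)) z v s).clm_apply
      (hasDerivAt_const s v)
    refine h.congr_deriv ?_
    simp

/-- Second order Taylor expansion with a uniform cubic remainder. -/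
lemma exists_taylor_two_bound {G : ℂ → ℝ} (hG : ContDiff ℝ 3 G) (hc : HasCompactSupport G) :
    ∃ K : ℝ, ∀ z v : ℂ, |G (z + v) - G z - fderiv ℝ G z v - fderiv ℝ (fderiv ℝ G) z v v / 2| ≤
      K * ‖v‖ ^ 3 := by
  obtain ⟨C, hC⟩ := exists_lipschitzWith_fderiv_fderiv hG hc
  refine ⟨C, fun z v => ?_⟩
  have hM : 0 ≤ (C : ℝ) * ‖v‖ ^ 3 := by positivity
  have h := abs_taylor_two_le (hasDerivAt_comp_line (hG.differentiable three_ne_zero) z v)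
    (hasDerivAt_fderiv_line hG z v) hM (abs_fderiv_fderiv_line_sub_le hC z v)
  rw [Complex.ofReal_one, Complex.ofReal_zero, one_mul, zero_mul, add_zero] at h
  exact h

open Laplacian in
/-- The circle mean of a smooth function differs from its value at the centre by a quarter of
`ε²` times the Laplacian, up to a uniform cubic error. -/
lemma exists_circleAverage_sub_laplacian_bound {G : ℂ → ℝ} (hG : ContDiff ℝ 3 G)
    (hc : HasCompactSupport G) :
    ∃ K : ℝ, ∀ (z : ℂ) (ε : ℝ), 0 ≤ ε →
      |Real.circleAverage G z ε - G z - ε ^ 2 / 4 * Δ G z| ≤ K * ε ^ 3 := by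
  obtain ⟨K, hK⟩ := exists_taylor_two_bound hG hc
  refine ⟨K, fun z ε hε => ?_⟩
  set A := fderiv ℝ G z with hA
  set B := fderiv ℝ (fderiv ℝ G) z with hB
  set Q : ℂ → ℝ := fun w => G z + A (w - z) + B (w - z) (w - z) / 2 with hQ
  have hQc : Continuous Q := by
    have : Continuous fun w => B (w - z) (w - z) :=
      (B.continuous.comp (continuous_sub_right z)).clm_apply (continuous_sub_right z)
    exact (continuous_const.add (A.continuous.comp (continuous_sub_right z))).add
      (this.div_const 2)
  have hQi : CircleIntegrable Q z ε := hQc.continuousOn.circleIntegrable hε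
  have hGi : CircleIntegrable G z ε := hG.continuous.continuousOn.circleIntegrable hε
  -- Over a circle the linear and mixed terms average to zero, while `cos²` and `sin²` average to
  -- `1/2`; this leaves the trace of the Hessian.
  have hQavg : Real.circleAverage Q z ε = G z + ε ^ 2 / 4 * Δ G z := by
    rw [laplacian_eq_fderiv_fderiv, ← hB, Real.circleAverage]
    have hv : ∀ θ : ℝ, circleMap z ε θ - z =
        (ε * Real.cos θ) • (1 : ℂ) + (ε * Real.sin θ) • Complex.I := by
      intro θ
      rw [circleMap, add_sub_cancel_left, Complex.exp_mul_I]
      simp only [Complex.real_smul]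
      push_cast
      ring
    have hpt : ∀ θ : ℝ, Q (circleMap z ε θ) = G z + (ε * A 1) * Real.cos θ
        + (ε * A Complex.I) * Real.sin θ + (ε ^ 2 / 2 * B 1 1) * Real.cos θ ^ 2
        + (ε ^ 2 / 2 * B Complex.I Complex.I) * Real.sin θ ^ 2
        + (ε ^ 2 / 2 * (B 1 Complex.I + B Complex.I 1)) * (Real.sin θ * Real.cos θ) := by
      intro θ
      simp only [hQ, hv, map_add, map_smul, add_apply,
        smul_apply, smul_eq_mul]
      ring
    simp only [hpt]
    have i0 : ∀ {g : ℝ → ℝ}, Continuous g → IntervalIntegrable g volume 0 (2 * Real.pi) :=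
      fun h => h.intervalIntegrable _ _
    rw [intervalIntegral.integral_add (i0 (by fun_prop)) (i0 (by fun_prop)),
      intervalIntegral.integral_add (i0 (by fun_prop)) (i0 (by fun_prop)),
      intervalIntegral.integral_add (i0 (by fun_prop)) (i0 (by fun_prop)),
      intervalIntegral.integral_add (i0 (by fun_prop)) (i0 (by fun_prop)),
      intervalIntegral.integral_add (i0 (by fun_prop)) (i0 (by fun_prop))]
    simp only [intervalIntegral.integral_const_mul, intervalIntegral.integral_const,
      integral_cos, integral_sin, integral_cos_sq, integral_sin_sq, integral_sin_mul_cos₁]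
    simp only [Real.sin_two_pi, Real.cos_two_pi, Real.sin_zero, Real.cos_zero, smul_eq_mul]
    field_simp
    ring
  have e : Real.circleAverage G z ε - G z - ε ^ 2 / 4 * Δ G z =
      Real.circleAverage (fun w => G w - Q w) z ε := by
    rw [Real.circleAverage_fun_sub hGi hQi, hQavg]; ring
  rw [e]
  refine Real.abs_circleAverage_le_circleAverage_abs.trans ?_
  refine Real.circleAverage_mono_on_of_le_circle ?_ fun w hw => ?_
  · exact (hG.continuous.sub hQc).abs.continuousOn.circleIntegrable hε
  · have := hK z (w - z)
    rw [abs_of_nonneg hε, mem_sphere, dist_eq_norm] at hw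
    rw [add_sub_cancel, hw] at this
    have e : G w - Q w = G w - G z - A (w - z) - B (w - z) (w - z) / 2 := by
      simp only [hQ]
      ring
    change |G w - Q w| ≤ _
    rw [e]
    exact this

/-! ### The one-sided Green formula -/

/-- Taking circle means is a symmetric operation for the Lebesgue pairing. -/
lemma integral_mul_circleAverage_comm {u G : ℂ → ℝ} (hu : Integrable u) (hG : Continuous G)
    (hc : HasCompactSupport G) (ε : ℝ) :
    Integrable (fun z => u z * Real.circleAverage G z ε) ∧
      Integrable (fun z => G z * Real.circleAverage u z ε) ∧
      ∫ z, u z * Real.circleAverage G z ε = ∫ z, G z * Real.circleAverage u z ε := by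
  set μ : Measure ℝ := volume.restrict (Set.Ioc 0 (2 * Real.pi)) with hμ
  have hpi : (0 : ℝ) ≤ 2 * Real.pi := by positivity
  set w : ℝ → ℂ := fun θ => circleMap 0 ε θ with hw
  have hwc : Continuous w := continuous_circleMap 0 ε
  obtain ⟨C, hC⟩ := hc.exists_bound_of_continuous hG
  have hadd : ∀ (z : ℂ) (θ : ℝ), circleMap z ε θ = z + w θ := by
    intro z θ; simp [hw, circleMap]
  have hsub : ∀ (z : ℂ) (θ : ℝ), circleMap z (-ε) θ = z - w θ := by
    intro z θ; simp [hw, circleMap, sub_eq_add_neg]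
  have hus : Integrable (fun p : ℂ × ℝ => u p.1) (volume.prod μ) := hu.comp_fst μ
  have hI1 : Integrable (fun p : ℂ × ℝ => u p.1 * G (p.1 + w p.2)) (volume.prod μ) := by
    refine hus.mul_bdd (c := C) ?_ ?_
    · exact (hG.comp (continuous_fst.add (hwc.comp continuous_snd))).aestronglyMeasurable
    · exact Filter.Eventually.of_forall fun p => hC _
  have hI2 : Integrable (fun p : ℂ × ℝ => G p.1 * u (p.1 - w p.2)) (volume.prod μ) := by
    have hmp : MeasurePreserving (fun p : ℝ × ℂ => (p.1, p.2 - w p.1))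
        (μ.prod volume) (μ.prod volume) := by
      refine (MeasurePreserving.id μ).skew_product (g := fun θ z => z - w θ) ?_ ?_
      · exact (continuous_snd.sub (hwc.comp continuous_fst)).measurable
      · exact Filter.Eventually.of_forall fun θ => map_sub_right_eq_self volume (w θ)
    have h3 : Integrable (fun p : ℝ × ℂ => u (p.2 - w p.1)) (μ.prod volume) :=
      hmp.integrable_comp_of_integrable (hu.comp_snd μ)
    refine h3.swap.bdd_mul (c := C) ?_ ?_
    · exact (hG.comp continuous_fst).aestronglyMeasurable
    · exact Filter.Eventually.of_forall fun p => hC _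
  have hA : ∀ z, Real.circleAverage G z ε = (2 * Real.pi)⁻¹ * ∫ θ, G (z + w θ) ∂μ := by
    intro z
    rw [Real.circleAverage, intervalIntegral.integral_of_le hpi, smul_eq_mul]
    simp only [hadd, hμ]
  have hB : ∀ z, Real.circleAverage u z ε = (2 * Real.pi)⁻¹ * ∫ θ, u (z - w θ) ∂μ := by
    intro z
    -- Reversing the sign of the radius turns `z + w θ` into `z - w θ`, the form produced by
    -- translating the variable `z`.
    rw [← Real.circleAverage_neg_radius, Real.circleAverage,
      intervalIntegral.integral_of_le hpi, smul_eq_mul]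
    simp only [hsub, hμ]
  have hA' : ∀ z, u z * Real.circleAverage G z ε =
      (2 * Real.pi)⁻¹ * ∫ θ, u z * G (z + w θ) ∂μ := by
    intro z; rw [hA, integral_const_mul]; ring
  have hB' : ∀ z, G z * Real.circleAverage u z ε =
      (2 * Real.pi)⁻¹ * ∫ θ, G z * u (z - w θ) ∂μ := by
    intro z; rw [hB, integral_const_mul]; ring
  simp only [hA', hB']
  refine ⟨hI1.integral_prod_left.const_mul _, hI2.integral_prod_left.const_mul _, ?_⟩
  rw [integral_const_mul, integral_const_mul,
    integral_integral_swap (f := fun z θ => u z * G (z + w θ)) hI1,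
    integral_integral_swap (f := fun z θ => G z * u (z - w θ)) hI2]
  congr 2
  ext θ
  rw [← integral_sub_right_eq_self (fun z => u z * G (z + w θ)) (w θ)]
  congr 1
  ext z
  rw [sub_add_cancel, mul_comm]

/-- On the half-radius disc `log (ε / |z - a|) ≥ log 2`. Replacing the logarithmic kernel by this
constant loses sharpness but leaves only the area of a disc to integrate. -/
lemma sum_order_indicator_le {f : ℂ → ℂ} {z : ℂ} {ε : ℝ} (hε : 0 < ε)
    (hf : AnalyticOnNhd ℂ f (closedBall z ε)) (hz : f z ≠ 0) (S : Finset ℂ) :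
    ∑ a ∈ S, (analyticOrderNatAt f a : ℝ) *
        (closedBall a (ε / 2)).indicator (fun _ => Real.log 2) z ≤
      Real.circleAverage (fun z => Real.log ‖f z‖) z ε - Real.log ‖f z‖ := by
  refine (Finset.sum_le_sum fun a _ => ?_).trans (sum_order_mul_posLog_le hε hf hz S)
  by_cases haz : z = a
  · subst haz
    have : analyticOrderNatAt f z = 0 := by
      rw [analyticOrderNatAt, (hf z (mem_closedBall_self hε.le)).analyticOrderAt_eq_zero.2 hz]
      rfl
    simp [this]
  · gcongr
    by_cases hm : z ∈ closedBall a (ε / 2)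
    · rw [Set.indicator_of_mem hm]
      rw [mem_closedBall, dist_eq_norm] at hm
      have hpos : 0 < ‖z - a‖ := norm_pos_iff.2 (sub_ne_zero.2 haz)
      refine le_trans (Real.log_le_log two_pos ?_) (le_max_right _ _)
      rw [le_div_iff₀ hpos]; linarith
    · rw [Set.indicator_of_notMem hm]; exact Real.posLog_nonneg

lemma ae_ne_zero_of_differentiableOn {f : ℂ → ℂ} (hf : DifferentiableOn ℂ f (ball 0 1))
    (h0 : f 0 ≠ 0) : ∀ᵐ z : ℂ, z ∈ ball (0 : ℂ) 1 → f z ≠ 0 := by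
  have h1 := (hf.analyticOnNhd isOpen_ball).preimage_zero_mem_codiscreteWithin h0
    (mem_ball_self one_pos) ((convex_ball (0 : ℂ) 1).isConnected ⟨0, mem_ball_self one_pos⟩)
  rw [← ae_restrict_iff' measurableSet_ball]
  exact ae_restrict_le_codiscreteWithin measurableSet_ball h1

open Laplacian in
lemma laplacian_eq_zero_of_ball {G : ℂ → ℝ} {ρ : ℝ} (hG : ∀ z, ρ < ‖z‖ → G z = 0) {z : ℂ}
    (hz : ρ < ‖z‖) : Δ G z = 0 := by
  have h : G =ᶠ[nhds z] fun _ => 0 := by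
    filter_upwards [continuous_norm.continuousAt.eventually (lt_mem_nhds hz)] with w hw
    exact hG w hw
  rw [(InnerProductSpace.laplacian_congr_nhds h).eq_of_nhds]
  simp

open Laplacian in
lemma continuous_laplacian {G : ℂ → ℝ} (hG : ContDiff ℝ 3 G) : Continuous (Δ G) := by
  have h2 : Continuous (fderiv ℝ (fderiv ℝ G)) :=
    ((hG.fderiv_right (m := 2) (by norm_num)).fderiv_right (m := 1) (by norm_num)).continuous
  have e : Δ G = fun z => fderiv ℝ (fderiv ℝ G) z 1 1 +
      fderiv ℝ (fderiv ℝ G) z Complex.I Complex.I := funext (laplacian_eq_fderiv_fderiv G)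
  rw [e]
  fun_prop

open Laplacian in
/-- A one-sided Green formula: testing `log |f|` against the Laplacian of a nonnegative test
function controls the values of the test function at the zeros of `f`. -/
theorem sum_order_mul_le_integral_laplacian {f : ℂ → ℂ} (hf : DifferentiableOn ℂ f (ball 0 1))
    (h0 : ‖f 0‖ = 1) {G : ℂ → ℝ} (hG : ContDiff ℝ 3 G) {ρ : ℝ} (hρ : ρ < 1)
    (hsupp : ∀ z, ρ < ‖z‖ → G z = 0) (hpos : ∀ z, 0 ≤ G z) (S : Finset ℂ) :
    Real.pi * Real.log 2 * ∑ a ∈ S, (analyticOrderNatAt f a : ℝ) * G a ≤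
      ∫ z, Real.log ‖f z‖ * Δ G z := by
  have hc : HasCompactSupport G :=
    HasCompactSupport.intro (isCompact_closedBall (0 : ℂ) ρ) fun z hz => hsupp z (by simpa using hz)
  have hf0 : f 0 ≠ 0 := by rw [← norm_pos_iff, h0]; exact one_pos
  obtain ⟨K, hK⟩ := exists_circleAverage_sub_laplacian_bound hG hc
  obtain ⟨C, hC⟩ := (hG.of_le (by norm_num : (1 : WithTop ℕ∞) ≤ 3)).lipschitzWith_of_hasCompactSupport
    hc one_ne_zero
  -- Midway between the support of `G` and the unit circle: circles of radius `ε < (1 - ρ) / 2`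
  -- centred in the support stay in the disc where `u` is `log |f|`.
  set ρ' : ℝ := (1 + ρ) / 2 with hρ'
  set u : ℂ → ℝ := (ball (0 : ℂ) ρ').indicator fun z => Real.log ‖f z‖ with hu
  have hui : Integrable u :=
    (integrable_indicator_iff measurableSet_ball).2
      (integrableOn_log_norm hf h0 (by rw [hρ']; linarith))
  have huΔ : ∀ z, Real.log ‖f z‖ * Δ G z = u z * Δ G z := by
    intro z
    by_cases hz : z ∈ ball (0 : ℂ) ρ'
    · rw [hu, Set.indicator_of_mem hz]
    · rw [mem_ball_zero_iff, not_lt] at hz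
      rw [laplacian_eq_zero_of_ball hsupp (by linarith)]; simp
  simp only [huΔ]
  have hΔc : HasCompactSupport (Δ G) :=
    HasCompactSupport.intro (isCompact_closedBall (0 : ℂ) ρ) fun z hz =>
      laplacian_eq_zero_of_ball hsupp (by simpa using hz)
  obtain ⟨CΔ, hCΔ⟩ := hΔc.exists_bound_of_continuous (continuous_laplacian hG)
  have huΔi : Integrable fun z => u z * Δ G z :=
    hui.mul_bdd (c := CΔ) (continuous_laplacian hG).aestronglyMeasurable
      (Filter.Eventually.of_forall hCΔ)
  obtain ⟨CG, hCG⟩ := hc.exists_bound_of_continuous hG.continuous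
  set N : ℝ := ∑ a ∈ S, (analyticOrderNatAt f a : ℝ) with hN
  -- Pairing `G` with the circle mean of `u` minus `u` gives a lower bound by Jensen, and an upper
  -- bound by moving the mean onto `G` and expanding. Both have size `ε² / 4`; after division the
  -- errors are `O(ε)`.
  have key : ∀ ε ∈ Set.Ioo 0 ((1 - ρ) / 2),
      Real.pi * Real.log 2 * ∑ a ∈ S, (analyticOrderNatAt f a : ℝ) * G a ≤
        (∫ z, u z * Δ G z) + (4 * K * ∫ z, |u z|) * ε + Real.pi * Real.log 2 * N * C * ε := by
    rintro ε ⟨hε, hε1⟩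
    obtain ⟨hi', hi, hcomm⟩ := integral_mul_circleAverage_comm hui hG.continuous hc ε
    have hGu : Integrable fun z => G z * u z :=
      hui.bdd_mul (c := CG) hG.continuous.aestronglyMeasurable (Filter.Eventually.of_forall hCG)
    have hlow : (∑ a ∈ S, (analyticOrderNatAt f a : ℝ) *
          (Real.log 2 * (G a - C * ε) * (Real.pi * ε ^ 2 / 4))) ≤
        ∫ z, (G z * Real.circleAverage u z ε - G z * u z) := by
      set k : ℂ → ℂ → ℝ := fun a => (closedBall a (ε / 2)).indicator fun _ => Real.log 2 with hk
      have hki : ∀ a, Integrable (k a) := fun a =>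
        (integrable_indicator_iff measurableSet_closedBall).2
          (integrableOn_const measure_closedBall_lt_top.ne)
      have hkint : ∀ a, ∫ z, k a z = Real.log 2 * (Real.pi * ε ^ 2 / 4) := by
        intro a
        rw [hk, integral_indicator measurableSet_closedBall, setIntegral_const, measureReal_def,
          Complex.volume_closedBall, ENNReal.toReal_mul, ENNReal.toReal_pow,
          ENNReal.toReal_ofReal (by positivity)]
        simp
        ring
      have hk0 : ∀ a z, 0 ≤ k a z := fun a z =>
        Set.indicator_nonneg (fun _ _ => Real.log_nonneg one_le_two) z
      have hGk : ∀ a, Integrable fun z => G z * k a z := fun a =>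
        (hki a).bdd_mul (c := CG) hG.continuous.aestronglyMeasurable
          (Filter.Eventually.of_forall hCG)
      -- The Lipschitz bound allows `G z` to be replaced by `G a - C ε` near `a`; no sign of the
      -- latter is needed.
      have h1 : ∀ a, Real.log 2 * (G a - C * ε) * (Real.pi * ε ^ 2 / 4) ≤
          ∫ z, G z * k a z := by
        intro a
        have : ∫ z, (G a - C * ε) * k a z ≤ ∫ z, G z * k a z := by
          refine integral_mono ((hki a).const_mul _) (hGk a) fun z => ?_
          by_cases hz : z ∈ closedBall a (ε / 2)
          · refine mul_le_mul_of_nonneg_right ?_ (hk0 a z)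
            have h2 := hC.dist_le_mul a z
            rw [dist_comm a z, Real.dist_eq] at h2
            rw [mem_closedBall] at hz
            have h3 : (C : ℝ) * dist z a ≤ C * ε := by gcongr; linarith
            linarith [le_abs_self (G a - G z)]
          · simp [hk, Set.indicator_of_notMem hz]
        rw [integral_const_mul, hkint] at this
        linarith
      calc _ ≤ ∑ a ∈ S, (analyticOrderNatAt f a : ℝ) * ∫ z, G z * k a z := by
            gcongr with a ha; exact h1 a
        _ = ∫ z, ∑ a ∈ S, (analyticOrderNatAt f a : ℝ) * (G z * k a z) := by
            rw [integral_finsetSum _ fun a _ => (hGk a).const_mul _]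
            simp only [integral_const_mul]
        _ ≤ _ := by
            refine integral_mono_ae (integrable_finsetSum _ fun a _ => (hGk a).const_mul _)
              (hi.sub hGu) ?_
            filter_upwards [ae_ne_zero_of_differentiableOn hf hf0] with z hz
            by_cases hzρ : ρ < ‖z‖
            · simp [hsupp z hzρ]
            · rw [not_lt] at hzρ
              have hzε : ‖z‖ + ε < ρ' := by rw [hρ']; linarith
              have h2 := sum_order_indicator_le hε
                (analyticOnNhd_closedBall hf (by linarith)) (hz (by simpa using by linarith)) S
              have h3 : Real.circleAverage u z ε =
                  Real.circleAverage (fun z => Real.log ‖f z‖) z ε := by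
                refine Real.circleAverage_congr_sphere fun w hw => ?_
                rw [abs_of_pos hε, mem_sphere, dist_eq_norm] at hw
                refine Set.indicator_of_mem ?_ _
                rw [mem_ball_zero_iff]
                have := norm_add_le z (w - z)
                rw [add_sub_cancel] at this
                linarith
              have h4 : u z = Real.log ‖f z‖ :=
                Set.indicator_of_mem (by rw [mem_ball_zero_iff]; linarith) _
              have h5 := mul_le_mul_of_nonneg_left h2 (hpos z)
              rw [Finset.mul_sum] at h5
              rw [h3, h4, ← mul_sub]
              refine le_trans (le_of_eq (Finset.sum_congr rfl fun a _ => ?_)) h5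
              ring
    have hup : ∫ z, (G z * Real.circleAverage u z ε - G z * u z) ≤
        ε ^ 2 / 4 * (∫ z, u z * Δ G z) + K * ε ^ 3 * ∫ z, |u z| := by
      have hGu' : Integrable fun z => u z * G z := by simpa only [mul_comm] using hGu
      rw [integral_sub hi hGu, ← hcomm]
      simp only [mul_comm (G _) (u _)]
      rw [← integral_sub hi' hGu', ← integral_const_mul, ← integral_const_mul,
        ← integral_add (huΔi.const_mul _) (hui.abs.const_mul _)]
      refine integral_mono (hi'.sub hGu') ((huΔi.const_mul _).add (hui.abs.const_mul _))
        fun z => ?_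
      have h1 : u z * (Real.circleAverage G z ε - G z - ε ^ 2 / 4 * Δ G z) ≤
          |u z| * (K * ε ^ 3) := by
        refine (le_abs_self _).trans ?_
        rw [abs_mul]
        exact mul_le_mul_of_nonneg_left (hK z ε hε.le) (abs_nonneg _)
      linarith
    have h := hlow.trans hup
    have e : (∑ a ∈ S, (analyticOrderNatAt f a : ℝ) *
          (Real.log 2 * (G a - C * ε) * (Real.pi * ε ^ 2 / 4))) =
        ε ^ 2 / 4 * (Real.pi * Real.log 2 * ∑ a ∈ S, (analyticOrderNatAt f a : ℝ) * G a -
          Real.pi * Real.log 2 * N * C * ε) := by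
      have : ∀ a ∈ S, (analyticOrderNatAt f a : ℝ) *
          (Real.log 2 * (G a - C * ε) * (Real.pi * ε ^ 2 / 4)) =
          ε ^ 2 / 4 * Real.pi * Real.log 2 * ((analyticOrderNatAt f a : ℝ) * G a) -
            ε ^ 2 / 4 * Real.pi * Real.log 2 * C * ε * (analyticOrderNatAt f a : ℝ) :=
        fun a _ => by ring
      rw [Finset.sum_congr rfl this, Finset.sum_sub_distrib, ← Finset.mul_sum, ← Finset.mul_sum]
      ring
    rw [e] at h
    have hε2 : 0 < ε ^ 2 / 4 := by positivity
    refine le_of_mul_le_mul_left ?_ hε2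
    linarith
  have hlim : Filter.Tendsto (fun ε : ℝ => (∫ z, u z * Δ G z) + (4 * K * ∫ z, |u z|) * ε +
      Real.pi * Real.log 2 * N * C * ε) (nhdsWithin 0 (Set.Ioi 0))
      (nhds (∫ z, u z * Δ G z)) := by
    have : Continuous fun ε : ℝ => (∫ z, u z * Δ G z) + (4 * K * ∫ z, |u z|) * ε +
      Real.pi * Real.log 2 * N * C * ε := by fun_prop
    have h := (this.tendsto 0).mono_left (nhdsWithin_le_nhds (s := Set.Ioi 0))
    simpa using h
  refine ge_of_tendsto hlim ?_
  filter_upwards [Ioo_mem_nhdsGT (show (0 : ℝ) < (1 - ρ) / 2 by linarith)] with ε hε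
  exact key ε hε

/-! ### The smooth cutoff near the boundary -/

/-- A smooth step from `0` on `(-∞, τ]` to `1` on `[2τ, ∞)`. -/
noncomputable def step (τ x : ℝ) : ℝ := Real.smoothTransition ((x - τ) / τ)

lemma contDiff_step (τ : ℝ) (n : ℕ) : ContDiff ℝ n (step τ) :=
  Real.smoothTransition.contDiff.comp ((contDiff_id.sub contDiff_const).div_const τ)

lemma continuous_step (τ : ℝ) : Continuous (step τ) := (contDiff_step τ 0).continuous

lemma hasDerivAt_step (τ x : ℝ) : HasDerivAt (step τ) (deriv (step τ) x) x :=
  (((contDiff_step τ 1).differentiable (by norm_num)) x).hasDerivAt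

lemma step_nonneg (τ x : ℝ) : 0 ≤ step τ x := Real.smoothTransition.nonneg _

lemma step_le_one (τ x : ℝ) : step τ x ≤ 1 := Real.smoothTransition.le_one _

lemma monotone_step {τ : ℝ} (hτ : 0 < τ) : Monotone (step τ) := fun x y h =>
  Real.smoothTransition.monotone (by gcongr)

lemma step_eq_zero {τ x : ℝ} (hτ : 0 < τ) (hx : x ≤ τ) : step τ x = 0 :=
  Real.smoothTransition.zero_of_nonpos (div_nonpos_of_nonpos_of_nonneg (by linarith) hτ.le)

lemma step_eq_one {τ x : ℝ} (hτ : 0 < τ) (hx : 2 * τ ≤ x) : step τ x = 1 :=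
  Real.smoothTransition.one_of_one_le (by rw [le_div_iff₀ hτ]; linarith)

lemma deriv_step_nonneg {τ : ℝ} (hτ : 0 < τ) (x : ℝ) : 0 ≤ deriv (step τ) x :=
  (monotone_step hτ).deriv_nonneg

lemma deriv_step_eq_zero {τ x : ℝ} (hτ : 0 < τ) (hx : 2 * τ < x) : deriv (step τ) x = 0 := by
  have : step τ =ᶠ[nhds x] fun _ => 1 := by
    filter_upwards [lt_mem_nhds hx] with y hy
    exact step_eq_one hτ hy.le
  rw [this.deriv_eq, deriv_const]

/-- A smooth convex function vanishing on `(-∞, τ]` with derivative `step τ`. -/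
noncomputable def cutoff (τ x : ℝ) : ℝ := ∫ t in (0 : ℝ)..x, step τ t

lemma hasDerivAt_cutoff (τ x : ℝ) : HasDerivAt (cutoff τ) (step τ x) x :=
  intervalIntegral.integral_hasDerivAt_right ((continuous_step τ).intervalIntegrable _ _)
    (continuous_step τ).stronglyMeasurable.stronglyMeasurableAtFilter
    (continuous_step τ).continuousAt

lemma contDiff_cutoff (τ : ℝ) : ContDiff ℝ 3 (cutoff τ) := by
  have h : deriv (cutoff τ) = step τ := funext fun x => (hasDerivAt_cutoff τ x).deriv
  rw [show (3 : WithTop ℕ∞) = 2 + 1 by norm_num, contDiff_succ_iff_deriv, h]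
  exact ⟨fun x => (hasDerivAt_cutoff τ x).differentiableAt, by simp, contDiff_step τ 2⟩

lemma cutoff_eq_zero {τ x : ℝ} (hτ : 0 < τ) (hx : x ≤ τ) : cutoff τ x = 0 := by
  rw [cutoff, intervalIntegral.integral_congr (g := fun _ => 0)]
  · simp
  · intro t ht
    refine step_eq_zero hτ (ht.2.trans ?_)
    exact sup_le hτ.le hx

lemma cutoff_nonneg {τ : ℝ} (hτ : 0 < τ) (x : ℝ) : 0 ≤ cutoff τ x := by
  rcases le_total 0 x with h | h
  · exact intervalIntegral.integral_nonneg h fun t _ => step_nonneg τ t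
  · rw [cutoff_eq_zero hτ (h.trans hτ.le)]

/-- The derivative `step τ` is increasing, so its integral up to `x` is at most `x` times its final
value. The factor `step τ x` is kept so that `cutoff` terms can be absorbed into `step` terms of the
Laplacian. -/
lemma cutoff_le_mul_step {τ x : ℝ} (hτ : 0 < τ) (hx : 0 ≤ x) : cutoff τ x ≤ x * step τ x := by
  have h := intervalIntegral.integral_mono_on hx ((continuous_step τ).intervalIntegrable 0 x)
    ((continuous_const (y := step τ x)).intervalIntegrable (μ := volume) 0 x)
    fun t ht => monotone_step hτ ht.2
  rw [intervalIntegral.integral_const, sub_zero, smul_eq_mul] at h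
  exact h

lemma sub_le_cutoff {τ x : ℝ} (hτ : 0 < τ) (hx : 2 * τ ≤ x) : x - 2 * τ ≤ cutoff τ x := by
  have h1 := intervalIntegral.integral_add_adjacent_intervals
    ((continuous_step τ).intervalIntegrable (μ := volume) 0 (2 * τ))
    ((continuous_step τ).intervalIntegrable (2 * τ) x)
  have h2 : ∫ t in (2 * τ)..x, step τ t = x - 2 * τ := by
    rw [intervalIntegral.integral_congr (g := fun _ => 1)]
    · simp
    · intro t ht
      rw [Set.uIcc_of_le hx] at ht
      exact step_eq_one hτ ht.1
  have h3 : 0 ≤ ∫ t in (0 : ℝ)..(2 * τ), step τ t :=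
    intervalIntegral.integral_nonneg (by linarith) fun t _ => step_nonneg τ t
  rw [cutoff, ← h1, h2]
  linarith

/-! ### The test function and its Laplacian -/

lemma fderiv_fderiv_apply_eq {G : ℂ → ℝ} (hG : ContDiff ℝ 3 G) {z v : ℂ} {g' : ℝ → ℝ} {d : ℝ}
    (h1 : ∀ᶠ s in nhds (0 : ℝ), HasDerivAt (fun s : ℝ => G (z + s * v)) (g' s) s)
    (h2 : HasDerivAt g' d 0) : fderiv ℝ (fderiv ℝ G) z v v = d := by
  have h3 := hasDerivAt_fderiv_line hG z v 0
  rw [Complex.ofReal_zero, zero_mul, add_zero] at h3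
  refine h3.unique (h2.congr_of_eventuallyEq ?_)
  filter_upwards [h1] with s hs
  exact (hasDerivAt_comp_line (hG.differentiable three_ne_zero) z v s).unique hs

/-- First derivative of `cutoff τ (x s) * exp (V s)`. -/
lemma hasDerivAt_cutoff_mul_exp {τ : ℝ} {x V : ℝ → ℝ} {x' V' s : ℝ} (hx : HasDerivAt x x' s)
    (hV : HasDerivAt V V' s) :
    HasDerivAt (fun s => cutoff τ (x s) * Real.exp (V s))
      (Real.exp (V s) * (step τ (x s) * x' + cutoff τ (x s) * V')) s := by
  refine (((hasDerivAt_cutoff τ (x s)).comp s hx).mul hV.exp).congr_deriv ?_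
  simp only [Function.comp_apply]
  ring

/-- Second derivative of `cutoff τ (x s) * exp (V s)`. -/
lemma hasDerivAt_cutoff_mul_exp_two {τ : ℝ} {x V x' V' : ℝ → ℝ} {x'' V'' s : ℝ}
    (hx : HasDerivAt x (x' s) s) (hV : HasDerivAt V (V' s) s) (hx' : HasDerivAt x' x'' s)
    (hV' : HasDerivAt V' V'' s) :
    HasDerivAt (fun s => Real.exp (V s) * (step τ (x s) * x' s + cutoff τ (x s) * V' s))
      (Real.exp (V s) * (deriv (step τ) (x s) * x' s ^ 2 + step τ (x s) * (x'' + 2 * x' s * V' s)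
        + cutoff τ (x s) * (V' s ^ 2 + V''))) s := by
  refine (hV.exp.mul ((((hasDerivAt_step τ (x s)).comp s hx).mul hx').add
    (((hasDerivAt_cutoff τ (x s)).comp s hx).mul hV'))).congr_deriv ?_
  simp only [Function.comp_apply, Pi.add_apply, Pi.mul_apply]
  ring

/-- The gradient of `∑ⱼ pⱼ log |z - ηⱼ| + α (1 - |z|²)`, as a complex number. -/
noncomputable def gradLog (η : Fin n → ℂ) (p : Fin n → ℝ) (α : ℝ) (z : ℂ) : ℂ :=
  ∑ j, ((p j / Complex.normSq (z - η j) : ℝ) : ℂ) * (z - η j) - (2 * α : ℝ) * z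

/-- The test function `cutoff(1 - |z|²) |R̃(z)| exp(α (1 - |z|²))`. -/
noncomputable def testFn (η : Fin n → ℂ) (p : Fin n → ℝ) (α τ : ℝ) (z : ℂ) : ℝ :=
  cutoff τ (1 - Complex.normSq z) * (absR η p z * Real.exp (α * (1 - Complex.normSq z)))

lemma sub_ne_zero_of_mem_disc {η : Fin n → ℂ} (hη : ∀ j, ‖η j‖ = 1) {z : ℂ} (hz : ‖z‖ < 1)
    (j : Fin n) : z - η j ≠ 0 := by
  intro h
  rw [sub_eq_zero] at h
  rw [h, hη j] at hz
  exact lt_irrefl _ hz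

/-- Inside the disc the weight is an exponential, so line derivatives reduce to those of the
exponent; `p j / 2` compensates for the squared distance. -/
lemma absR_mul_exp_eq {η : Fin n → ℂ} (hη : ∀ j, ‖η j‖ = 1) (p : Fin n → ℝ) (x : ℝ) {z : ℂ}
    (hz : ‖z‖ < 1) : absR η p z * Real.exp x =
      Real.exp (∑ j, p j / 2 * Real.log (Complex.normSq (z - η j)) + x) := by
  rw [Real.exp_add, Real.exp_sum, absR]
  congr 1
  refine Finset.prod_congr rfl fun j _ => ?_
  have h : 0 < ‖z - η j‖ := norm_pos_iff.2 (sub_ne_zero_of_mem_disc hη hz j)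
  rw [Complex.normSq_eq_norm_sq, Real.log_pow, Real.rpow_def_of_pos h]
  congr 1
  push_cast
  ring

lemma testFn_eq_zero {η : Fin n → ℂ} {p : Fin n → ℝ} {α τ : ℝ} (hτ : 0 < τ) {z : ℂ}
    (hz : 1 - Complex.normSq z ≤ τ) : testFn η p α τ z = 0 := by
  rw [testFn, cutoff_eq_zero hτ hz, zero_mul]

lemma testFn_nonneg {η : Fin n → ℂ} {p : Fin n → ℝ} {α τ : ℝ} (hτ : 0 < τ) (z : ℂ) :
    0 ≤ testFn η p α τ z :=
  mul_nonneg (cutoff_nonneg hτ _) (mul_nonneg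
    (Finset.prod_nonneg fun _ _ => Real.rpow_nonneg (norm_nonneg _) _) (Real.exp_nonneg _))

lemma contDiff_normSq {m : WithTop ℕ∞} : ContDiff ℝ m (fun z : ℂ => Complex.normSq z) := by
  have : (fun z : ℂ => Complex.normSq z) = fun z => ‖z‖ ^ 2 :=
    funext fun z => Complex.normSq_eq_norm_sq z
  rw [this]
  exact contDiff_norm_sq ℝ

/-- Inside the disc no factor `|z - η_j|` vanishes, so real powers are smooth. On and outside the
unit circle the cutoff vanishes in a neighbourhood, which hides the singularities at the `η_j`. -/
lemma contDiff_testFn {η : Fin n → ℂ} (hη : ∀ j, ‖η j‖ = 1) (p : Fin n → ℝ) (α : ℝ) {τ : ℝ}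
    (hτ : 0 < τ) : ContDiff ℝ 3 (testFn η p α τ) := by
  rw [contDiff_iff_contDiffAt]
  intro z
  by_cases hz : ‖z‖ < 1
  · have hX : ContDiff ℝ 3 fun z : ℂ => 1 - Complex.normSq z := contDiff_const.sub contDiff_normSq
    refine ((contDiff_cutoff τ).comp hX).contDiffAt.mul (ContDiffAt.mul ?_ ?_)
    · unfold absR
      refine contDiffAt_prod fun j _ => ?_
      refine ContDiffAt.rpow_const_of_ne ?_ ?_
      · exact (contDiffAt_id.sub contDiffAt_const).norm ℝ (sub_ne_zero_of_mem_disc hη hz j)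
      · exact norm_ne_zero_iff.2 (sub_ne_zero_of_mem_disc hη hz j)
    · exact (Real.contDiff_exp.comp (contDiff_const.mul hX)).contDiffAt
  · have h : testFn η p α τ =ᶠ[nhds z] fun _ => 0 := by
      have hc : Continuous fun z : ℂ => 1 - Complex.normSq z :=
        continuous_const.sub Complex.continuous_normSq
      have : 1 - Complex.normSq z < τ := by
        rw [Complex.normSq_eq_norm_sq]; nlinarith
      filter_upwards [hc.continuousAt.eventually (gt_mem_nhds this)] with w hw
      exact testFn_eq_zero hτ hw.le
    exact contDiffAt_const.congr_of_eventuallyEq h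

lemma normSq_add_real_mul (w e : ℂ) (s : ℝ) : Complex.normSq (w + s * e) =
    Complex.normSq w + 2 * s * (w.re * e.re + w.im * e.im) + s ^ 2 * Complex.normSq e := by
  simp only [Complex.normSq_apply, Complex.add_re, Complex.add_im, Complex.mul_re, Complex.mul_im,
    Complex.ofReal_re, Complex.ofReal_im]
  ring

lemma hasDerivAt_normSq_line (w e : ℂ) (s : ℝ) :
    HasDerivAt (fun s : ℝ => Complex.normSq (w + s * e))
      (2 * (w.re * e.re + w.im * e.im) + 2 * s * Complex.normSq e) s := by
  simp only [normSq_add_real_mul]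
  have := ((((hasDerivAt_id s).const_mul 2).mul_const (w.re * e.re + w.im * e.im)).const_add
    (Complex.normSq w)).add (((hasDerivAt_id s).pow 2).mul_const (Complex.normSq e))
  refine this.congr_deriv ?_
  simp

/-- Second derivative of the test function in the direction of a unit vector `e`. -/
lemma fderiv_fderiv_testFn {η : Fin n → ℂ} (hη : ∀ j, ‖η j‖ = 1) (p : Fin n → ℝ) (α : ℝ) {τ : ℝ}
    (hτ : 0 < τ) {z : ℂ} (hz : ‖z‖ < 1) {e : ℂ} (he : Complex.normSq e = 1) :
    fderiv ℝ (fderiv ℝ (testFn η p α τ)) z e e =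
      absR η p z * Real.exp (α * (1 - Complex.normSq z)) *
      (deriv (step τ) (1 - Complex.normSq z) * (2 * (z.re * e.re + z.im * e.im)) ^ 2 +
        step τ (1 - Complex.normSq z) * (-2 + 2 * (-2 * (z.re * e.re + z.im * e.im)) *
          ((gradLog η p α z).re * e.re + (gradLog η p α z).im * e.im)) +
        cutoff τ (1 - Complex.normSq z) *
          (((gradLog η p α z).re * e.re + (gradLog η p α z).im * e.im) ^ 2 +
          (∑ j, p j * (1 / Complex.normSq (z - η j) -
            2 * ((z - η j).re * e.re + (z - η j).im * e.im) ^ 2 / Complex.normSq (z - η j) ^ 2) -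
            2 * α))) := by
  set N : Fin n → ℝ → ℝ := fun j s => Complex.normSq (z - η j + s * e) with hN
  set b : Fin n → ℝ := fun j => (z - η j).re * e.re + (z - η j).im * e.im with hb
  set c : ℝ := z.re * e.re + z.im * e.im with hc
  set x : ℝ → ℝ := fun s => 1 - Complex.normSq (z + s * e) with hx
  set x' : ℝ → ℝ := fun s => -(2 * c + 2 * s) with hx'
  set V : ℝ → ℝ := fun s => ∑ j, p j / 2 * Real.log (N j s) + α * x s with hV
  set V' : ℝ → ℝ := fun s => ∑ j, p j * ((b j + s) / N j s) + α * x' s with hV'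
  have dN : ∀ j s, HasDerivAt (N j) (2 * b j + 2 * s) s := by
    intro j s
    have := hasDerivAt_normSq_line (z - η j) e s
    rwa [he, mul_one] at this
  have dx : ∀ s, HasDerivAt x (x' s) s := by
    intro s
    have := (hasDerivAt_normSq_line z e s).const_sub 1
    rwa [he, mul_one] at this
  have dx' : ∀ s, HasDerivAt x' (-2) s := by
    intro s
    refine ((((hasDerivAt_id s).const_mul 2).const_add (2 * c)).neg).congr_deriv ?_
    simp
  have dV : ∀ s : ℝ, (∀ j, N j s ≠ 0) → HasDerivAt V (V' s) s := by
    intro s hs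
    refine ((HasDerivAt.fun_sum fun j (_ : j ∈ Finset.univ) =>
      ((dN j s).log (hs j)).const_mul (p j / 2)).add ((dx s).const_mul α)).congr_deriv ?_
    simp only [hV']
    congr 1
    refine Finset.sum_congr rfl fun j _ => ?_
    ring
  have dV' : ∀ s : ℝ, (∀ j, N j s ≠ 0) → HasDerivAt V'
      (∑ j, p j * ((1 * N j s - (b j + s) * (2 * b j + 2 * s)) / N j s ^ 2) + α * (-2)) s := by
    intro s hs
    exact (HasDerivAt.fun_sum fun j (_ : j ∈ Finset.univ) =>
      ((((hasDerivAt_id s).const_add (b j)).div (dN j s) (hs j)).const_mul (p j))).add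
        ((dx' s).const_mul α)
  have hNne : ∀ s : ℝ, ‖z + s * e‖ < 1 → ∀ j, N j s ≠ 0 := by
    intro s hs j
    have := sub_ne_zero_of_mem_disc hη hs j
    simp only [hN]
    rw [ne_eq, Complex.normSq_eq_zero]
    rwa [add_sub_right_comm] at this
  have hz0 : ‖z + (0 : ℝ) * e‖ < 1 := by simpa using hz
  have hev : ∀ᶠ s : ℝ in nhds 0, ‖z + s * e‖ < 1 := by
    have : Continuous fun s : ℝ => ‖z + s * e‖ := by fun_prop
    exact this.continuousAt.eventually (gt_mem_nhds hz0)
  have h1 : ∀ᶠ s : ℝ in nhds 0, HasDerivAt (fun s : ℝ => testFn η p α τ (z + s * e))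
      (Real.exp (V s) * (step τ (x s) * x' s + cutoff τ (x s) * V' s)) s := by
    filter_upwards [hev.eventually_nhds] with s hs
    refine (hasDerivAt_cutoff_mul_exp (dx s) (dV s (hNne s hs.self_of_nhds))).congr_of_eventuallyEq ?_
    filter_upwards [hs] with t ht
    rw [testFn, absR_mul_exp_eq hη p _ ht]
    simp only [hV, hx, hN, add_sub_right_comm]
  have h2 := hasDerivAt_cutoff_mul_exp_two (τ := τ) (dx 0) (dV 0 (hNne 0 hz0)) (dx' 0)
    (dV' 0 (hNne 0 hz0))
  rw [fderiv_fderiv_apply_eq (contDiff_testFn hη p α hτ) h1 h2]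
  have ex : x 0 = 1 - Complex.normSq z := by simp [hx]
  have eN : ∀ j, N j 0 = Complex.normSq (z - η j) := by intro j; simp [hN]
  have eV : Real.exp (V 0) = absR η p z * Real.exp (α * (1 - Complex.normSq z)) := by
    rw [absR_mul_exp_eq hη p _ hz]
    simp only [hV, eN, ex]
  have eV' : V' 0 = (gradLog η p α z).re * e.re + (gradLog η p α z).im * e.im := by
    simp only [hV', hx', eN, gradLog, Complex.sub_re, Complex.sub_im, Complex.re_sum,
      Complex.im_sum, Complex.re_ofReal_mul, Complex.im_ofReal_mul, sub_mul, Finset.sum_mul]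
    rw [sub_add_sub_comm, ← Finset.sum_add_distrib, hc, sub_eq_add_neg]
    congr 1
    · refine Finset.sum_congr rfl fun j _ => ?_
      simp only [hb, Complex.sub_re, Complex.sub_im]
      ring
    · ring
  have eV'' : ∑ j, p j * ((1 * N j 0 - (b j + 0) * (2 * b j + 2 * 0)) / N j 0 ^ 2) + α * (-2) =
      ∑ j, p j * (1 / Complex.normSq (z - η j) - 2 * b j ^ 2 / Complex.normSq (z - η j) ^ 2) -
        2 * α := by
    rw [sub_eq_add_neg]
    congr 1
    · refine Finset.sum_congr rfl fun j _ => ?_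
      have := hNne 0 hz0 j
      rw [← eN j]
      field_simp
      ring
    · ring
  rw [eV, eV', ex, eV'']
  simp only [hx']
  ring

-- The Hessian is summed over the directions `1` and `I`. Two identities simplify it: `log |z -
-- η_j|` is harmonic (`e1`), and `2 Re(z conj(z - η_j)) = |z - η_j|² - (1 - |z|²)` because `|η_j| =
-- 1`, which evaluates the radial derivative of the exponent (`e2`).
open Laplacian in
lemma laplacian_testFn {η : Fin n → ℂ} (hη : ∀ j, ‖η j‖ = 1) (p : Fin n → ℝ) (α : ℝ) {τ : ℝ}
    (hτ : 0 < τ) {z : ℂ} (hz : ‖z‖ < 1) :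
    Δ (testFn η p α τ) z = absR η p z * Real.exp (α * (1 - Complex.normSq z)) *
      (4 * Complex.normSq z * deriv (step τ) (1 - Complex.normSq z) +
        step τ (1 - Complex.normSq z) * (-4 - 2 * ∑ j, p j + 8 * α * Complex.normSq z +
          2 * (1 - Complex.normSq z) * ∑ j, p j / Complex.normSq (z - η j)) +
        cutoff τ (1 - Complex.normSq z) * (Complex.normSq (gradLog η p α z) - 4 * α)) := by
  rw [laplacian_eq_fderiv_fderiv, fderiv_fderiv_testFn hη p α hτ hz (by simp),
    fderiv_fderiv_testFn hη p α hτ hz (by simp), ← mul_add]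
  congr 1
  simp only [Complex.one_re, Complex.one_im, Complex.I_re, Complex.I_im, mul_one, mul_zero,
    add_zero, zero_add]
  have hN : ∀ j, Complex.normSq (z - η j) ≠ 0 := fun j =>
    Complex.normSq_eq_zero.not.2 (sub_ne_zero_of_mem_disc hη hz j)
  have e1 : (∑ j, p j * (1 / Complex.normSq (z - η j) -
      2 * (z - η j).re ^ 2 / Complex.normSq (z - η j) ^ 2)) +
      ∑ j, p j * (1 / Complex.normSq (z - η j) -
      2 * (z - η j).im ^ 2 / Complex.normSq (z - η j) ^ 2) = 0 := by
    rw [← Finset.sum_add_distrib]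
    refine Finset.sum_eq_zero fun j _ => ?_
    have h := hN j
    field_simp
    rw [Complex.normSq_apply]
    ring
  have e2 : 2 * (z.re * (gradLog η p α z).re + z.im * (gradLog η p α z).im) =
      ∑ j, p j - (1 - Complex.normSq z) * ∑ j, p j / Complex.normSq (z - η j) -
        4 * α * Complex.normSq z := by
    simp only [gradLog, Complex.sub_re, Complex.sub_im, Complex.re_sum, Complex.im_sum,
      Complex.re_ofReal_mul, Complex.im_ofReal_mul, mul_sub, Finset.mul_sum]
    rw [sub_add_sub_comm, mul_sub, ← Finset.sum_add_distrib, Finset.mul_sum, ← Finset.sum_sub_distrib,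
      Complex.normSq_apply z]
    congr 1
    · refine Finset.sum_congr rfl fun j _ => ?_
      have h := hN j
      have h1 : (η j).re * (η j).re + (η j).im * (η j).im = 1 := by
        rw [← Complex.normSq_apply, Complex.normSq_eq_norm_sq, hη j, one_pow]
      have h2 : Complex.normSq (z - η j) = z.re * z.re + z.im * z.im + 1 -
          2 * (z.re * (η j).re + z.im * (η j).im) := by
        rw [← h1, Complex.normSq_apply, Complex.sub_re, Complex.sub_im]; ring
      field_simp
      rw [h2]
      ring
    · ring
  rw [Complex.normSq_apply (gradLog η p α z)]
  linear_combination (cutoff τ (1 - Complex.normSq z)) * e1 -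
    2 * step τ (1 - Complex.normSq z) * e2 - 4 * deriv (step τ) (1 - Complex.normSq z) * Complex.normSq_apply z

/-! ### Elementary estimates of the weights -/

lemma absR_nonneg (η : Fin n → ℂ) (q : Fin n → ℝ) (z : ℂ) : 0 ≤ absR η q z :=
  Finset.prod_nonneg fun _ _ => Real.rpow_nonneg (norm_nonneg _) _

lemma gammaWeight_nonneg (η : Fin n → ℂ) (q : Fin n → ℝ) (z : ℂ) : 0 ≤ gammaWeight η q z :=
  Finset.sum_nonneg fun _ _ => by positivity

lemma norm_sub_le_two {η : ℂ} (hη : ‖η‖ = 1) {z : ℂ} (hz : ‖z‖ < 1) : ‖z - η‖ ≤ 2 := by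
  linarith [norm_sub_le z η]

/-- A factor with negative exponent is bounded below because `|z - η_j| ≤ 2`, so discarding it costs
only a constant. -/
lemma absR_posPart_le {η : Fin n → ℂ} (hη : ∀ j, ‖η j‖ = 1) (q : Fin n → ℝ) {z : ℂ}
    (hz : ‖z‖ < 1) :
    absR η (fun j => max (q j) 0) z ≤ 2 ^ (∑ j, |q j|) * absR η q z := by
  rw [absR, absR, Real.rpow_sum_of_pos two_pos, ← Finset.prod_mul_distrib]
  refine Finset.prod_le_prod (fun _ _ => Real.rpow_nonneg (norm_nonneg _) _) fun j _ => ?_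
  have h : 0 < ‖z - η j‖ := norm_pos_iff.2 (sub_ne_zero_of_mem_disc hη hz j)
  have h2 := norm_sub_le_two (hη j) hz
  rcases le_total 0 (q j) with hq | hq
  · rw [max_eq_left hq]
    exact le_mul_of_one_le_left (Real.rpow_nonneg h.le _)
      (Real.one_le_rpow one_le_two (abs_nonneg _))
  · rw [max_eq_right hq, Real.rpow_zero, abs_of_nonpos hq, Real.rpow_neg two_pos.le,
      ← Real.inv_rpow two_pos.le, ← Real.mul_rpow (by positivity) h.le]
    refine Real.one_le_rpow_of_pos_of_le_one_of_nonpos (by positivity) ?_ hq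
    linarith

lemma absR_posPart_le_const {η : Fin n → ℂ} (hη : ∀ j, ‖η j‖ = 1) (q : Fin n → ℝ) {z : ℂ}
    (hz : ‖z‖ < 1) : absR η (fun j => max (q j) 0) z ≤ 2 ^ (∑ j, |q j|) := by
  rw [absR, Real.rpow_sum_of_pos two_pos]
  refine Finset.prod_le_prod (fun _ _ => Real.rpow_nonneg (norm_nonneg _) _) fun j _ => ?_
  refine (Real.rpow_le_rpow (norm_nonneg _) (norm_sub_le_two (hη j) hz) (le_max_right _ _)).trans ?_
  exact Real.rpow_le_rpow_of_exponent_le one_le_two (max_le (le_abs_self _) (abs_nonneg _))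

lemma le_absR {η : Fin n → ℂ} (hη : ∀ j, ‖η j‖ = 1) (q : Fin n → ℝ) {z : ℂ} (hz : ‖z‖ ≤ 3 / 4) :
    (1 / 4) ^ (∑ j, |q j|) ≤ absR η q z := by
  rw [absR, Real.rpow_sum_of_pos (by norm_num)]
  refine Finset.prod_le_prod (fun _ _ => by positivity) fun j _ => ?_
  have h2 := norm_sub_le_two (hη j) (lt_of_le_of_lt hz (by norm_num))
  have h1 : 1 / 4 ≤ ‖z - η j‖ := by
    have := norm_sub_norm_le (η j) z
    rw [norm_sub_rev, hη j] at this
    linarith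
  rcases le_total 0 (q j) with hq | hq
  · rw [abs_of_nonneg hq]
    exact Real.rpow_le_rpow (by norm_num) h1 hq
  · rw [abs_of_nonpos hq, one_div, Real.inv_rpow (by norm_num), Real.rpow_neg (by norm_num), inv_inv]
    exact Real.rpow_le_rpow_of_nonpos (by linarith) (by linarith) hq

lemma le_gammaWeight {η : Fin n → ℂ} (hη : ∀ j, ‖η j‖ = 1) (q : Fin n → ℝ) (j : Fin n) {z : ℂ}
    (hz : ‖z‖ < 1) : |q j| / 2 ≤ gammaWeight η q z := by
  have h : 0 < ‖z - η j‖ := norm_pos_iff.2 (sub_ne_zero_of_mem_disc hη hz j)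
  refine le_trans ?_ (Finset.single_le_sum (f := fun j => |q j| * ‖z - η j‖⁻¹)
    (fun _ _ => by positivity) (Finset.mem_univ j))
  rw [div_eq_mul_inv]
  gcongr
  exact norm_sub_le_two (hη j) hz

/-- The distance from `z` to `η` is at least the distance `1 - |z|` to the circle. This lets a
factor `1 - |z|²` cancel one power of `|z - η_j|⁻¹`. -/
lemma one_sub_normSq_le {η : ℂ} (hη : ‖η‖ = 1) {z : ℂ} (hz : ‖z‖ < 1) :
    1 - Complex.normSq z ≤ 2 * ‖z - η‖ := by
  have h := norm_sub_norm_le η z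
  rw [norm_sub_rev, hη] at h
  rw [Complex.normSq_eq_norm_sq]
  nlinarith [norm_nonneg z]

lemma one_sub_normSq_mul_gammaWeight_le {η : Fin n → ℂ} (hη : ∀ j, ‖η j‖ = 1) (q : Fin n → ℝ)
    {z : ℂ} (hz : ‖z‖ < 1) :
    (1 - Complex.normSq z) * gammaWeight η q z ≤ 2 * ∑ j, |q j| := by
  rw [gammaWeight, Finset.mul_sum, Finset.mul_sum]
  refine Finset.sum_le_sum fun j _ => ?_
  have h : 0 < ‖z - η j‖ := norm_pos_iff.2 (sub_ne_zero_of_mem_disc hη hz j)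
  have h1 := one_sub_normSq_le (hη j) hz
  calc (1 - Complex.normSq z) * (|q j| * ‖z - η j‖⁻¹)
      ≤ 2 * ‖z - η j‖ * (|q j| * ‖z - η j‖⁻¹) := by gcongr
    _ = 2 * |q j| := by field_simp

lemma one_sub_normSq_mul_sum_le {η : Fin n → ℂ} (hη : ∀ j, ‖η j‖ = 1) (q : Fin n → ℝ)
    {z : ℂ} (hz : ‖z‖ < 1) :
    (1 - Complex.normSq z) * ∑ j, max (q j) 0 / Complex.normSq (z - η j) ≤
      2 * gammaWeight η q z := by
  rw [gammaWeight, Finset.mul_sum, Finset.mul_sum]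
  refine Finset.sum_le_sum fun j _ => ?_
  have h : 0 < ‖z - η j‖ := norm_pos_iff.2 (sub_ne_zero_of_mem_disc hη hz j)
  have h1 := one_sub_normSq_le (hη j) hz
  have h2 : max (q j) 0 ≤ |q j| := max_le (le_abs_self _) (abs_nonneg _)
  have h3 : 0 ≤ max (q j) 0 := le_max_right _ _
  rw [Complex.normSq_eq_norm_sq (z - η j)]
  calc (1 - Complex.normSq z) * (max (q j) 0 / ‖z - η j‖ ^ 2)
      ≤ 2 * ‖z - η j‖ * (max (q j) 0 / ‖z - η j‖ ^ 2) := by gcongr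
    _ = 2 * (max (q j) 0 * ‖z - η j‖⁻¹) := by field_simp
    _ ≤ 2 * (|q j| * ‖z - η j‖⁻¹) := by gcongr

lemma norm_gradLog_le {η : Fin n → ℂ} (hη : ∀ j, ‖η j‖ = 1) (q : Fin n → ℝ) {α : ℝ} (hα : 0 ≤ α)
    {z : ℂ} (hz : ‖z‖ < 1) :
    ‖gradLog η (fun j => max (q j) 0) α z‖ ≤ gammaWeight η q z + 2 * α := by
  rw [gradLog]
  refine (norm_sub_le _ _).trans (add_le_add ((norm_sum_le _ _).trans ?_) ?_)
  · refine Finset.sum_le_sum fun j _ => ?_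
    have h : 0 < ‖z - η j‖ := norm_pos_iff.2 (sub_ne_zero_of_mem_disc hη hz j)
    have h2 : max (q j) 0 ≤ |q j| := max_le (le_abs_self _) (abs_nonneg _)
    have h3 : 0 ≤ max (q j) 0 := le_max_right _ _
    rw [norm_mul, Complex.norm_real, Complex.normSq_eq_norm_sq, Real.norm_of_nonneg (by positivity)]
    calc max (q j) 0 / ‖z - η j‖ ^ 2 * ‖z - η j‖ = max (q j) 0 * ‖z - η j‖⁻¹ := by field_simp
      _ ≤ _ := by gcongr
  · rw [norm_mul, Complex.norm_real, Real.norm_of_nonneg (by positivity)]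
    exact mul_le_of_le_one_right (by positivity) hz.le

lemma normSq_le_one {z : ℂ} (hz : ‖z‖ < 1) : Complex.normSq z ≤ 1 := by
  rw [Complex.normSq_eq_norm_sq]
  exact pow_le_one₀ (norm_nonneg z) hz.le

/-! ### Two-sided bounds on the Laplacian of the test function -/

open Laplacian in
/-- The Laplacian of the test function is nonnegative near the boundary. -/
lemma neg_laplacian_testFn_le {η : Fin n → ℂ} (hη : ∀ j, ‖η j‖ = 1) (q : Fin n → ℝ) :
    ∃ C : ℝ, 0 ≤ C ∧ ∀ τ > 0, ∀ z : ℂ, ‖z‖ < 1 →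
      -(Δ (testFn η (fun j => max (q j) 0) (2 + ∑ j, max (q j) 0) τ) z) ≤
        (ball (0 : ℂ) (3 / 4)).indicator (fun _ => C) z := by
  set P : ℝ := ∑ j, max (q j) 0 with hP
  have hP0 : 0 ≤ P := Finset.sum_nonneg fun _ _ => le_max_right _ _
  -- With this choice `4 + 2P = 2α`, so the lower bound `-4 - 2P - 4α + 12αN` equals `6α(2N - 1)`,
  -- nonnegative once `N ≥ 1/2`; the radius `3/4` gives `N ≥ 9/16`.
  set α : ℝ := 2 + P with hα
  refine ⟨2 ^ (∑ j, |q j|) * Real.exp α * (4 + 2 * P + 4 * α), by positivity,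
    fun τ hτ z hz => ?_⟩
  rw [laplacian_testFn hη _ α hτ hz, ← hP]
  have hN := normSq_le_one hz
  have hN0 := Complex.normSq_nonneg z
  set N := Complex.normSq z with hNdef
  set σ := step τ (1 - N) with hσ
  have hσ0 : 0 ≤ σ := step_nonneg _ _
  have hσ1 : σ ≤ 1 := step_le_one _ _
  have hχ : cutoff τ (1 - N) ≤ (1 - N) * σ := cutoff_le_mul_step hτ (by linarith)
  have hχ0 : 0 ≤ cutoff τ (1 - N) := cutoff_nonneg hτ _
  have hd := deriv_step_nonneg hτ (1 - N)
  have hS : 0 ≤ ∑ j, max (q j) 0 / Complex.normSq (z - η j) :=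
    Finset.sum_nonneg fun j _ => div_nonneg (le_max_right _ _) (Complex.normSq_nonneg _)
  set S := ∑ j, max (q j) 0 / Complex.normSq (z - η j)
  set V := Complex.normSq (gradLog η (fun j => max (q j) 0) α z)
  have hV : 0 ≤ V := Complex.normSq_nonneg _
  set h := absR η (fun j => max (q j) 0) z * Real.exp (α * (1 - N)) with hh
  have hh0 : 0 ≤ h := mul_nonneg (absR_nonneg _ _ _) (Real.exp_nonneg _)
  have hh1 : h ≤ 2 ^ (∑ j, |q j|) * Real.exp α := by
    refine mul_le_mul (absR_posPart_le_const hη q hz) (Real.exp_le_exp.2 ?_)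
      (Real.exp_nonneg _) (by positivity)
    exact mul_le_of_le_one_right (by positivity) (by linarith)
  have hα0 : 0 ≤ α := by positivity
  -- All manifestly nonnegative terms are dropped; the remaining `-4α` times the cutoff is absorbed
  -- through `cutoff ≤ (1 - N) σ`.
  have key : σ * (-4 - 2 * P - 4 * α + 12 * α * N) ≤
      4 * N * deriv (step τ) (1 - N) + σ * (-4 - 2 * P + 8 * α * N + 2 * (1 - N) * S) +
        cutoff τ (1 - N) * (V - 4 * α) := by
    have h1 : 0 ≤ 4 * N * deriv (step τ) (1 - N) := by positivity
    have h2 : 0 ≤ σ * (2 * (1 - N) * S) :=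
      mul_nonneg hσ0 (mul_nonneg (by linarith) hS)
    have h3 : 0 ≤ cutoff τ (1 - N) * V := mul_nonneg hχ0 hV
    have h4 : cutoff τ (1 - N) * (4 * α) ≤ (1 - N) * σ * (4 * α) := by gcongr
    linarith
  by_cases hb : z ∈ ball (0 : ℂ) (3 / 4)
  · rw [Set.indicator_of_mem hb]
    have h5 : -(4 + 2 * P + 4 * α) ≤ σ * (-4 - 2 * P - 4 * α + 12 * α * N) := by
      have : 0 ≤ σ * (12 * α * N) := by positivity
      have h6 : σ * (4 + 2 * P + 4 * α) ≤ 4 + 2 * P + 4 * α :=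
        mul_le_of_le_one_left (by positivity) hσ1
      linarith
    have h7 := mul_le_mul_of_nonneg_left (h5.trans key) hh0
    have h8 : h * (4 + 2 * P + 4 * α) ≤ 2 ^ (∑ j, |q j|) * Real.exp α * (4 + 2 * P + 4 * α) := by
      gcongr
    linarith
  · rw [Set.indicator_of_notMem hb]
    rw [mem_ball_zero_iff, not_lt] at hb
    have hN2 : 9 / 16 ≤ N := by
      rw [hNdef, Complex.normSq_eq_norm_sq]; nlinarith
    have h5 : 0 ≤ σ * (-4 - 2 * P - 4 * α + 12 * α * N) := by
      refine mul_nonneg hσ0 ?_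
      have : α * (9 / 16) ≤ α * N := by gcongr
      linarith
    have := mul_nonneg hh0 (h5.trans key)
    linarith

-- The singular terms are `(1 - |z|²) / |z - η_j|²` and `(1 - |z|²) γ²`; the spare factor `1 - |z|²`
-- reduces each to order `γ`. The bounded terms are absorbed because a nonzero exponent keeps `γ`
-- bounded below.
open Laplacian in
lemma laplacian_testFn_le {η : Fin n → ℂ} (hη : ∀ j, ‖η j‖ = 1) (q : Fin n → ℝ) {j₀ : Fin n}
    (hq : q j₀ ≠ 0) {α : ℝ} (hα : 0 ≤ α) :
    ∃ C : ℝ, 0 ≤ C ∧ ∀ τ > 0, ∀ z : ℂ, ‖z‖ < 1 →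
      Δ (testFn η (fun j => max (q j) 0) α τ) z ≤
        C * (deriv (step τ) (1 - ‖z‖ ^ 2) * absR η q z) +
          C * (gammaWeight η q z * absR η q z) := by
  set Q : ℝ := ∑ j, |q j| with hQ
  have hQ0 : 0 ≤ Q := Finset.sum_nonneg fun _ _ => abs_nonneg _
  set γ₀ : ℝ := |q j₀| / 2 with hγ₀
  have hγ₀0 : 0 < γ₀ := by positivity
  -- Collects the bounded contributions: `8α` from the `step` term and `8α²` from the squared
  -- gradient.
  set A : ℝ := 8 * α + 8 * α ^ 2 with hA
  have hA0 : 0 ≤ A := by positivity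
  set B : ℝ := A / γ₀ + 4 + 4 * Q with hB
  have hB0 : 0 ≤ A / γ₀ := by positivity
  refine ⟨Real.exp α * 2 ^ Q * B, by positivity, fun τ hτ z hz => ?_⟩
  rw [laplacian_testFn hη _ α hτ hz, ← Complex.normSq_eq_norm_sq]
  have hN := normSq_le_one hz
  have hN0 := Complex.normSq_nonneg z
  have hγS := one_sub_normSq_mul_sum_le hη q hz
  have hXγ := one_sub_normSq_mul_gammaWeight_le hη q hz
  set N := Complex.normSq z with hNdef
  set σ := step τ (1 - N) with hσ
  have hσ0 : 0 ≤ σ := step_nonneg _ _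
  have hσ1 : σ ≤ 1 := step_le_one _ _
  have hχ : cutoff τ (1 - N) ≤ 1 - N :=
    (cutoff_le_mul_step hτ (by linarith)).trans (mul_le_of_le_one_right (by linarith) hσ1)
  have hχ0 : 0 ≤ cutoff τ (1 - N) := cutoff_nonneg hτ _
  have hd := deriv_step_nonneg hτ (1 - N)
  set D := deriv (step τ) (1 - N)
  have hP : 0 ≤ ∑ j, max (q j) 0 := Finset.sum_nonneg fun _ _ => le_max_right _ _
  set S := ∑ j, max (q j) 0 / Complex.normSq (z - η j)
  set γ := gammaWeight η q z with hγ
  have hγ0 : 0 ≤ γ := gammaWeight_nonneg η q z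
  have hγγ : γ₀ ≤ γ := le_gammaWeight hη q j₀ hz
  have hV : Complex.normSq (gradLog η (fun j => max (q j) 0) α z) ≤ 2 * γ ^ 2 + 8 * α ^ 2 := by
    rw [Complex.normSq_eq_norm_sq]
    have h1 := norm_gradLog_le hη q hα hz
    have h2 : ‖gradLog η (fun j => max (q j) 0) α z‖ ^ 2 ≤ (γ + 2 * α) ^ 2 :=
      pow_le_pow_left₀ (norm_nonneg _) h1 2
    linarith [sq_nonneg (γ - 2 * α)]
  set V := Complex.normSq (gradLog η (fun j => max (q j) 0) α z)
  have hV0 : 0 ≤ V := Complex.normSq_nonneg _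
  have key : 4 * N * D + σ * (-4 - 2 * ∑ j, max (q j) 0 + 8 * α * N + 2 * (1 - N) * S) +
      cutoff τ (1 - N) * (V - 4 * α) ≤ B * (D + γ) := by
    have k1 : 4 * N * D ≤ 4 * D := by nlinarith
    have k2 : σ * (-4 - 2 * ∑ j, max (q j) 0 + 8 * α * N + 2 * (1 - N) * S) ≤ 8 * α + 4 * γ := by
      have h1 : 8 * α * N ≤ 8 * α := mul_le_of_le_one_right (by positivity) hN
      have h2 : -4 - 2 * ∑ j, max (q j) 0 + 8 * α * N + 2 * (1 - N) * S ≤ 8 * α + 4 * γ := by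
        linarith
      exact (mul_le_mul_of_nonneg_left h2 hσ0).trans (mul_le_of_le_one_left (by positivity) hσ1)
    have k3 : cutoff τ (1 - N) * (V - 4 * α) ≤ 4 * Q * γ + 8 * α ^ 2 := by
      have h1 : cutoff τ (1 - N) * (4 * α) ≥ 0 := by positivity
      have h2 : cutoff τ (1 - N) * V ≤ (1 - N) * (2 * γ ^ 2 + 8 * α ^ 2) :=
        mul_le_mul hχ hV hV0 (by linarith)
      have h3 : (1 - N) * γ * γ ≤ 2 * Q * γ := mul_le_mul_of_nonneg_right hXγ hγ0
      have h4 : (1 - N) * (8 * α ^ 2) ≤ 8 * α ^ 2 := mul_le_of_le_one_left (by positivity) (by linarith)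
      linarith
    have k4 : A ≤ A / γ₀ * γ := by
      rw [div_mul_eq_mul_div, le_div_iff₀ hγ₀0]
      gcongr
    have k5 : 4 * D ≤ B * D := mul_le_mul_of_nonneg_right (by rw [hB]; linarith) hd
    have k6 : B * γ = A / γ₀ * γ + 4 * γ + 4 * Q * γ := by rw [hB]; ring
    rw [mul_add]
    linarith
  have hR := absR_posPart_le hη q hz
  have hR0 := absR_nonneg η (fun j => max (q j) 0) z
  have hE : Real.exp (α * (1 - N)) ≤ Real.exp α :=
    Real.exp_le_exp.2 (mul_le_of_le_one_right hα (by linarith))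
  have hB' : 0 ≤ B := by rw [hB]; positivity
  have hBD : 0 ≤ B * (D + γ) := by positivity
  refine (mul_le_mul_of_nonneg_left key (mul_nonneg hR0 (Real.exp_nonneg _))).trans ?_
  calc _ ≤ 2 ^ Q * absR η q z * Real.exp α * (B * (D + γ)) := by
        refine mul_le_mul_of_nonneg_right ?_ hBD
        exact mul_le_mul hR hE (Real.exp_nonneg _)
          (mul_nonneg (by positivity) (absR_nonneg η q z))
    _ = _ := by ring

/-- Here `x - 2τ ≥ x / 2` for `x = 1 - |a|²`, and the exponential factor is at least `1`. -/
lemma half_mul_absR_le_testFn {η : Fin n → ℂ} {p : Fin n → ℝ} {α τ : ℝ} (hα : 0 ≤ α)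
    (hτ : 0 < τ) {a : ℂ} (ha : ‖a‖ < 1) (h : 4 * τ ≤ 1 - ‖a‖ ^ 2) :
    (1 - ‖a‖ ^ 2) * absR η p a ≤ 2 * testFn η p α τ a := by
  have hN := normSq_le_one ha
  rw [testFn, ← Complex.normSq_eq_norm_sq] at *
  set x := 1 - Complex.normSq a with hx
  have h1 := sub_le_cutoff hτ (x := x) (by linarith)
  have h2 : 1 ≤ Real.exp (α * x) := Real.one_le_exp (mul_nonneg hα (by linarith))
  have h3 := absR_nonneg η p a
  have h4 : absR η p a ≤ absR η p a * Real.exp (α * x) := le_mul_of_one_le_right h3 h2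
  calc x * absR η p a ≤ (2 * cutoff τ x) * (absR η p a * Real.exp (α * x)) :=
        mul_le_mul (by linarith) h4 h3 (by linarith [cutoff_nonneg hτ x])
    _ = _ := by ring

/-! ### Weighted integrals controlled by the norm -/

lemma measurable_absR (η : Fin n → ℂ) (q : Fin n → ℝ) : Measurable (absR η q) := by
  unfold absR
  fun_prop

lemma measurable_gammaWeight (η : Fin n → ℂ) (q : Fin n → ℝ) : Measurable (gammaWeight η q) := by
  unfold gammaWeight
  fun_prop

/-- The first summand of `nevanlinnaNorm`. -/
lemma lintegral_circle_le_nevanlinnaNorm {η : Fin n → ℂ} {q : Fin n → ℝ} {δ : ℝ} {f : ℂ → ℂ}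
    {s : ℝ} (hs : s ∈ Set.Ioo (1 - δ) 1) :
    ∫⁻ θ in Set.Ioc (0 : ℝ) (2 * Real.pi), ENNReal.ofReal (absR η q (circleMap 0 s θ) *
        Real.posLog ‖f (circleMap 0 s θ)‖) ≤ nevanlinnaNorm η q δ f := by
  simp only [circleMap_zero]
  refine le_trans ?_ le_self_add
  exact le_iSup₂ (f := fun (s : ℝ) (_ : s ∈ Set.Ioo (1 - δ) 1) =>
    ∫⁻ θ in Set.Ioc (0 : ℝ) (2 * Real.pi),
      ENNReal.ofReal (absR η q (s * Complex.exp (θ * Complex.I)) *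
        Real.posLog ‖f (s * Complex.exp (θ * Complex.I))‖)) s hs

/-- Dilation by `s` has Jacobian factor `s⁻² ≥ 1`, so the dilated area integrals in the norm
dominate undilated ones over smaller discs. -/
lemma lintegral_ball_le_lintegral_comp_mul {g : ℂ → ℝ≥0∞} {s : ℝ} (hs : 0 < s) (hs1 : s < 1) :
    ∫⁻ z in ball (0 : ℂ) s, g z ≤ ∫⁻ z in ball (0 : ℂ) 1, g (s * z) := by
  rw [← lintegral_indicator measurableSet_ball, ← lintegral_indicator measurableSet_ball]
  have e : ∀ z : ℂ, (ball (0 : ℂ) 1).indicator (fun z => g (s * z)) z =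
      (ball (0 : ℂ) s).indicator g (s • z) := by
    intro z
    have : z ∈ ball (0 : ℂ) 1 ↔ s • z ∈ ball (0 : ℂ) s := by
      rw [mem_ball_zero_iff, mem_ball_zero_iff, norm_smul, Real.norm_of_nonneg hs.le]
      exact ⟨fun h => by nlinarith, fun h => by by_contra h'; nlinarith⟩
    by_cases hz : z ∈ ball (0 : ℂ) 1
    · rw [Set.indicator_of_mem hz, Set.indicator_of_mem (this.1 hz), Complex.real_smul]
    · rw [Set.indicator_of_notMem hz, Set.indicator_of_notMem (mt this.2 hz)]
  simp only [e]
  rw [← (measurableEmbedding_const_smul₀ hs.ne').lintegral_map, Measure.map_addHaar_smul _ hs.ne',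
    lintegral_smul_measure, smul_eq_mul]
  refine le_mul_of_one_le_left zero_le ?_
  rw [ENNReal.one_le_ofReal, Complex.finrank_real_complex, abs_of_nonneg (by positivity)]
  exact (one_le_inv₀ (by positivity)).2 (pow_le_one₀ hs.le hs1.le)

lemma lintegral_ball_le_nevanlinnaNorm {η : Fin n → ℂ} {q : Fin n → ℝ} {δ : ℝ} {f : ℂ → ℂ}
    {s : ℝ} (hs0 : 0 < s) (hs : s ∈ Set.Ioo (1 - δ) 1) :
    ∫⁻ z in ball (0 : ℂ) s, ENNReal.ofReal (gammaWeight η q z * absR η q z *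
      Real.posLog ‖f z‖) ≤ nevanlinnaNorm η q δ f := by
  refine (lintegral_ball_le_lintegral_comp_mul hs0 hs.2).trans ?_
  refine le_trans ?_ le_add_self
  exact le_iSup₂ (f := fun (s : ℝ) (_ : s ∈ Set.Ioo (1 - δ) 1) => ∫⁻ z in Metric.ball (0 : ℂ) 1,
      ENNReal.ofReal (gammaWeight η q (s * z) * absR η q (s * z) *
        Real.posLog ‖f (s * z)‖)) s hs

lemma lintegral_Ioo_eq_Ioc_of_periodic {g : ℝ → ℝ≥0∞} (hg : Function.Periodic g (2 * Real.pi)) :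
    ∫⁻ θ in Set.Ioo (-Real.pi) Real.pi, g θ = ∫⁻ θ in Set.Ioc 0 (2 * Real.pi), g θ := by
  rw [setLIntegral_congr Ioo_ae_eq_Ioc]
  have h1 := isAddFundamentalDomain_Ioc Real.two_pi_pos (-Real.pi)
  have h2 := isAddFundamentalDomain_Ioc Real.two_pi_pos 0
  rw [show -Real.pi + 2 * Real.pi = Real.pi by ring] at h1
  rw [zero_add] at h2
  refine h1.setLIntegral_eq h2 g ?_
  rintro ⟨x, hx⟩ y
  obtain ⟨k, rfl⟩ := AddSubgroup.mem_zmultiples_iff.1 hx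
  rw [AddSubgroup.vadd_def, vadd_eq_add, add_comm]
  exact hg.zsmul k y

/-- The weight `x ↦ deriv (step τ) (1 - r²)` has total radial mass at most one. -/
lemma lintegral_deriv_step_le {τ s : ℝ} (hτ : 0 < τ) (hs : s < 1) :
    ∫⁻ r in Set.Ioo 0 s, ENNReal.ofReal (r * deriv (step τ) (1 - r ^ 2)) ≤ 1 := by
  have hcont : Continuous fun r : ℝ => r * deriv (step τ) (1 - r ^ 2) := by
    have : Continuous (deriv (step τ)) := (contDiff_step τ 1).continuous_deriv (by norm_num)
    fun_prop
  refine (lintegral_mono_set (Set.Ioo_subset_Ioc_self.trans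
    (Set.Ioc_subset_Ioc_right hs.le))).trans ?_
  have hint : IntegrableOn (fun r : ℝ => r * deriv (step τ) (1 - r ^ 2)) (Set.Ioc 0 1) :=
    (hcont.intervalIntegrable 0 1).1
  rw [← ofReal_integral_eq_lintegral_ofReal hint, ← intervalIntegral.integral_of_le zero_le_one]
  · have hd : ∀ r ∈ Set.uIcc (0 : ℝ) 1, HasDerivAt (fun r : ℝ => -(step τ (1 - r ^ 2) / 2))
        (r * deriv (step τ) (1 - r ^ 2)) r := by
      intro r _
      refine ((((hasDerivAt_step τ (1 - r ^ 2)).comp r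
        (((hasDerivAt_id r).pow 2).const_sub 1)).div_const 2).neg).congr_deriv ?_
      simp
      ring
    rw [intervalIntegral.integral_eq_sub_of_hasDerivAt hd (hcont.intervalIntegrable 0 1),
      ENNReal.ofReal_le_one]
    have h1 := step_le_one τ 1
    have h2 := step_nonneg τ 0
    norm_num
    linarith
  · refine (ae_restrict_iff' measurableSet_Ioc).2 (Filter.Eventually.of_forall fun r hr => ?_)
    exact mul_nonneg hr.1.le (deriv_step_nonneg hτ _)

/-- In polar coordinates the weight depends on `r` alone, so each circle integral is bounded by the
norm and the radial weight integrates to at most one. -/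
lemma lintegral_deriv_step_mul_le {η : Fin n → ℂ} {q : Fin n → ℝ} {δ : ℝ} {f : ℂ → ℂ}
    (hf : DifferentiableOn ℂ f (ball 0 1)) (hδ : δ < 1) {τ s : ℝ}
    (hτ : 0 < τ) (hτδ : (1 - δ) ^ 2 < 1 - 2 * τ) (hs : s < 1) :
    ∫⁻ z in ball (0 : ℂ) s, ENNReal.ofReal (deriv (step τ) (1 - ‖z‖ ^ 2) * absR η q z *
      Real.posLog ‖f z‖) ≤ nevanlinnaNorm η q δ f := by
  set F := (ball (0 : ℂ) 1).indicator f with hF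
  have hFf : ∀ z ∈ ball (0 : ℂ) 1, F z = f z := fun z hz => Set.indicator_of_mem hz f
  have hFm : Measurable fun z => Real.posLog ‖F z‖ :=
    Real.continuous_posLog.measurable.comp (measurable_indicator_ball hf).norm
  have hdc : Measurable (deriv (step τ)) :=
    ((contDiff_step τ 1).continuous_deriv (by norm_num)).measurable
  have hm : Measurable fun z => ENNReal.ofReal (deriv (step τ) (1 - ‖z‖ ^ 2) * absR η q z *
      Real.posLog ‖F z‖) :=
    (((hdc.comp (measurable_norm.pow_const 2 |>.const_sub 1)).mul (measurable_absR η q)).mul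
      hFm).ennreal_ofReal
  have e1 : ∫⁻ z in ball (0 : ℂ) s, ENNReal.ofReal (deriv (step τ) (1 - ‖z‖ ^ 2) * absR η q z *
      Real.posLog ‖f z‖) = ∫⁻ z in ball (0 : ℂ) s, ENNReal.ofReal
      (deriv (step τ) (1 - ‖z‖ ^ 2) * absR η q z * Real.posLog ‖F z‖) :=
    setLIntegral_congr_fun measurableSet_ball fun z hz => by
      simp only [hFf z (ball_subset_ball hs.le hz)]
  rw [e1, lintegral_ball_eq_iterated hm]
  set N := nevanlinnaNorm η q δ f with hN
  have hr : ∀ r ∈ Set.Ioo 0 s, ENNReal.ofReal r * ∫⁻ θ in Set.Ioo (-Real.pi) Real.pi,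
      ENNReal.ofReal (deriv (step τ) (1 - ‖circleMap 0 r θ‖ ^ 2) * absR η q (circleMap 0 r θ) *
        Real.posLog ‖F (circleMap 0 r θ)‖) ≤
      ENNReal.ofReal (r * deriv (step τ) (1 - r ^ 2)) * N := by
    intro r hr
    have hd := deriv_step_nonneg hτ (1 - r ^ 2)
    have hrm : ∀ θ, F (circleMap 0 r θ) = f (circleMap 0 r θ) := fun θ =>
      hFf _ (by simpa [abs_of_pos hr.1] using hr.2.trans hs)
    simp only [norm_circleMap_zero, sq_abs, mul_assoc, ENNReal.ofReal_mul hd]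
    rw [lintegral_const_mul' _ _ ENNReal.ofReal_ne_top, ENNReal.ofReal_mul hr.1.le, mul_assoc]
    -- Where the radial weight survives, `r² ≥ 1 - 2τ > (1 - δ)²`, so `r` is an admissible radius in
    -- the supremum.
    by_cases hrτ : 2 * τ < 1 - r ^ 2
    · simp [deriv_step_eq_zero hτ hrτ]
    · gcongr
      rw [lintegral_Ioo_eq_Ioc_of_periodic]
      · simp only [hrm]
        refine lintegral_circle_le_nevanlinnaNorm ⟨?_, hr.2.trans hs⟩
        nlinarith [hr.1]
      · intro θ
        simp only [periodic_circleMap 0 r θ]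
  refine (setLIntegral_mono' measurableSet_Ioo hr).trans ?_
  rw [lintegral_mul_const'' _ (by
    have : Measurable fun r : ℝ => r * deriv (step τ) (1 - r ^ 2) :=
      measurable_id.mul (hdc.comp ((measurable_id.pow_const 2).const_sub 1))
    exact this.ennreal_ofReal.aemeasurable)]
  exact mul_le_of_le_one_left zero_le (lintegral_deriv_step_le hτ hs)

/-! ### The estimate for nontrivial exponents -/

lemma ofReal_integral_le_lintegral {α : Type*} [MeasurableSpace α] {μ : Measure α} (g : α → ℝ) :
    ENNReal.ofReal (∫ x, g x ∂μ) ≤ ∫⁻ x, ENNReal.ofReal (g x) ∂μ := by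
  by_cases hg : Integrable g μ
  · rw [integral_eq_lintegral_pos_part_sub_lintegral_neg_part hg]
    refine (ENNReal.ofReal_le_ofReal (sub_le_self _ ENNReal.toReal_nonneg)).trans ?_
    exact ENNReal.ofReal_toReal_le
  · rw [integral_undef hg, ENNReal.ofReal_zero]; exact zero_le

open Laplacian in
/-- The weighted zero sum against the test function, for nontrivial exponents. -/
lemma exists_testFn_sum_le {η : Fin n → ℂ} (hη : ∀ j, ‖η j‖ = 1) {q : Fin n → ℝ} {j₀ : Fin n}
    (hq : q j₀ ≠ 0) : ∃ C : ℝ≥0, ∀ f : ℂ → ℂ, DifferentiableOn ℂ f (ball 0 1) → ‖f 0‖ = 1 →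
      ∀ δ ∈ Set.Ioo (0 : ℝ) 1, ∀ τ ∈ Set.Ioo (0 : ℝ) 1, (1 - δ) ^ 2 < 1 - 2 * τ →
        ∀ S : Finset ℂ, ENNReal.ofReal (Real.pi * Real.log 2 *
          ∑ a ∈ S, (analyticOrderNatAt f a : ℝ) *
            testFn η (fun j => max (q j) 0) (2 + ∑ j, max (q j) 0) τ a) ≤
          C * nevanlinnaNorm η q δ f := by
  obtain ⟨C₁, hC₁, hneg⟩ := neg_laplacian_testFn_le hη q
  have hα : 0 ≤ 2 + ∑ j, max (q j) 0 :=
    add_nonneg two_pos.le (Finset.sum_nonneg fun _ _ => le_max_right _ _)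
  obtain ⟨C₂, hC₂, hle⟩ := laplacian_testFn_le hη q hq hα
  -- A lower bound for `γ |R|` on the disc of radius `3/4`.
  set c₃ : ℝ := |q j₀| / 2 * (1 / 4) ^ (∑ j, |q j|) with hc₃
  have hc₃0 : 0 < c₃ := by positivity
  refine ⟨(C₂ + C₂ + C₁ * c₃⁻¹).toNNReal, fun f hf h0 δ hδ τ hτ hτδ S => ?_⟩
  set G := testFn η (fun j => max (q j) 0) (2 + ∑ j, max (q j) 0) τ with hG
  set N := nevanlinnaNorm η q δ f with hN
  -- Since `(1 - τ / 2)² ≥ 1 - τ`, the cutoff vanishes beyond this radius.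
  set ρ : ℝ := 1 - τ / 2 with hρ
  have hsupp : ∀ z, ρ < ‖z‖ → G z = 0 := by
    intro z hz
    refine testFn_eq_zero hτ.1 ?_
    rw [Complex.normSq_eq_norm_sq]
    have : ρ ^ 2 ≤ ‖z‖ ^ 2 := pow_le_pow_left₀ (by linarith [hτ.2]) hz.le 2
    nlinarith [sq_nonneg τ]
  have hgreen := sum_order_mul_le_integral_laplacian hf h0
    (contDiff_testFn hη (fun j => max (q j) 0) (2 + ∑ j, max (q j) 0) hτ.1)
    (by linarith [hτ.1] : ρ < 1) hsupp (fun z => testFn_nonneg hτ.1 z) S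
  refine (ENNReal.ofReal_le_ofReal hgreen).trans ((ofReal_integral_le_lintegral _).trans ?_)
  -- One radius serves three purposes: it contains the support of `G`, contains the disc of radius
  -- `3/4`, and is admissible for the area part of the norm.
  obtain ⟨s, hs, hs1⟩ := exists_between
    (show max ρ (max (3 / 4) (1 - δ)) < 1 by
      simp only [max_lt_iff]; exact ⟨by linarith [hτ.1], by norm_num, by linarith [hδ.1]⟩)
  simp only [max_lt_iff] at hs
  obtain ⟨hs2, hs3, hs4⟩ := hs
  have hs0 : 0 < s := by linarith
  have hsb : ball (0 : ℂ) s ⊆ ball 0 1 := ball_subset_ball hs1.le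
  have hout : ∀ z, ENNReal.ofReal (Real.log ‖f z‖ * Δ G z) =
      (ball (0 : ℂ) s).indicator (fun z => ENNReal.ofReal (Real.log ‖f z‖ * Δ G z)) z := by
    intro z
    by_cases hz : z ∈ ball (0 : ℂ) s
    · rw [Set.indicator_of_mem hz]
    · rw [Set.indicator_of_notMem hz]
      rw [mem_ball_zero_iff, not_lt] at hz
      rw [laplacian_eq_zero_of_ball hsupp (by linarith)]; simp
  have hbase : ∫⁻ z in ball (0 : ℂ) (3 / 4), ENNReal.ofReal (-Real.log ‖f z‖) ≤
      ENNReal.ofReal c₃⁻¹ * N := by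
    refine (lintegral_negPart_ball_le hf h0 (by norm_num)).trans ?_
    calc ∫⁻ z in ball (0 : ℂ) (3 / 4), ENNReal.ofReal (Real.log ‖f z‖)
        ≤ ∫⁻ z in ball (0 : ℂ) (3 / 4), ENNReal.ofReal c₃⁻¹ *
            ENNReal.ofReal (gammaWeight η q z * absR η q z * Real.posLog ‖f z‖) := by
          refine setLIntegral_mono' measurableSet_ball fun z hz => ?_
          rw [mem_ball_zero_iff] at hz
          rw [← ENNReal.ofReal_mul (by positivity)]
          refine ENNReal.ofReal_le_ofReal ?_
          have h1 : c₃ ≤ gammaWeight η q z * absR η q z :=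
            mul_le_mul (le_gammaWeight hη q j₀ (by linarith)) (le_absR hη q hz.le)
              (by positivity) (gammaWeight_nonneg η q z)
          have h2 : Real.log ‖f z‖ ≤ Real.posLog ‖f z‖ := le_max_right _ _
          refine h2.trans ?_
          rw [le_inv_mul_iff₀ hc₃0]
          exact mul_le_mul_of_nonneg_right h1 Real.posLog_nonneg
      _ ≤ ENNReal.ofReal c₃⁻¹ * ∫⁻ z in ball (0 : ℂ) s,
            ENNReal.ofReal (gammaWeight η q z * absR η q z * Real.posLog ‖f z‖) := by
          rw [lintegral_const_mul' _ _ ENNReal.ofReal_ne_top]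
          gcongr
      _ ≤ _ := by
          gcongr
          exact lintegral_ball_le_nevanlinnaNorm hs0 ⟨hs4, hs1⟩
  refine (lintegral_congr hout).trans_le ?_
  rw [lintegral_indicator measurableSet_ball]
  set g₁ : ℂ → ℝ≥0∞ := fun z => ENNReal.ofReal C₂ * ENNReal.ofReal
    (deriv (step τ) (1 - ‖z‖ ^ 2) * absR η q z * Real.posLog ‖f z‖) with hg₁
  set g₂ : ℂ → ℝ≥0∞ := fun z => ENNReal.ofReal C₂ * ENNReal.ofReal
    (gammaWeight η q z * absR η q z * Real.posLog ‖f z‖) with hg₂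
  set g₃ : ℂ → ℝ≥0∞ := (ball (0 : ℂ) (3 / 4)).indicator fun z => ENNReal.ofReal C₁ *
    ENNReal.ofReal (-Real.log ‖f z‖) with hg₃
  have hpt : ∀ z ∈ ball (0 : ℂ) s, ENNReal.ofReal (Real.log ‖f z‖ * Δ G z) ≤
      g₁ z + g₂ z + g₃ z := by
    intro z hz
    have hz1 : ‖z‖ < 1 := by simpa using hsb hz
    have hd := deriv_step_nonneg hτ.1 (1 - ‖z‖ ^ 2)
    have hR := absR_nonneg η q z
    have hγ := gammaWeight_nonneg η q z
    rcases le_total 0 (Real.log ‖f z‖) with hl | hl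
    · have hp : Real.posLog ‖f z‖ = Real.log ‖f z‖ := max_eq_right hl
      refine le_trans ?_ le_self_add
      rw [hg₁, hg₂]
      simp only
      rw [hp, ← ENNReal.ofReal_mul hC₂, ← ENNReal.ofReal_mul hC₂,
        ← ENNReal.ofReal_add (by positivity) (by positivity)]
      refine ENNReal.ofReal_le_ofReal ?_
      have := mul_le_mul_of_nonneg_left (hle τ hτ.1 z hz1) hl
      refine this.trans (le_of_eq ?_)
      ring
    · refine le_trans ?_ le_add_self
      have h1 := mul_le_mul_of_nonneg_left (hneg τ hτ.1 z hz1) (neg_nonneg.2 hl)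
      rw [neg_mul_neg] at h1
      refine (ENNReal.ofReal_le_ofReal h1).trans ?_
      by_cases hb : z ∈ ball (0 : ℂ) (3 / 4)
      · rw [hg₃, Set.indicator_of_mem hb, Set.indicator_of_mem hb, mul_comm,
          ENNReal.ofReal_mul hC₁]
      · rw [Set.indicator_of_notMem hb, mul_zero, ENNReal.ofReal_zero]; exact zero_le
  refine (setLIntegral_mono' measurableSet_ball hpt).trans ?_
  have hfm : AEMeasurable f (volume.restrict (ball 0 s)) :=
    (hf.continuousOn.mono hsb).aemeasurable measurableSet_ball
  have hpm : AEMeasurable (fun z => Real.posLog ‖f z‖) (volume.restrict (ball 0 s)) :=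
    Real.continuous_posLog.measurable.comp_aemeasurable hfm.norm
  have hdc : Measurable (deriv (step τ)) :=
    ((contDiff_step τ 1).continuous_deriv (by norm_num)).measurable
  have hm₁ : AEMeasurable g₁ (volume.restrict (ball 0 s)) :=
    (((((hdc.comp (measurable_norm.pow_const 2 |>.const_sub 1)).mul
      (measurable_absR η q)).aemeasurable.mul hpm).ennreal_ofReal).const_mul _)
  have hm₂ : AEMeasurable g₂ (volume.restrict (ball 0 s)) :=
    ((((measurable_gammaWeight η q).mul (measurable_absR η q)).aemeasurable.mul
      hpm).ennreal_ofReal).const_mul _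
  have hm₁₂ : AEMeasurable (fun z => g₁ z + g₂ z) (volume.restrict (ball 0 s)) := hm₁.add hm₂
  rw [lintegral_add_left' hm₁₂, lintegral_add_left' hm₁, hg₁, hg₂, hg₃,
    lintegral_const_mul' _ _ ENNReal.ofReal_ne_top, lintegral_const_mul' _ _ ENNReal.ofReal_ne_top,
    setLIntegral_indicator measurableSet_ball, lintegral_const_mul' _ _ ENNReal.ofReal_ne_top]
  have hI : ball (0 : ℂ) (3 / 4) ∩ ball 0 s = ball 0 (3 / 4) :=
    Set.inter_eq_left.2 (ball_subset_ball hs3.le)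
  rw [hI]
  have hc : ((C₂ + C₂ + C₁ * c₃⁻¹).toNNReal : ℝ≥0∞) =
      ENNReal.ofReal C₂ + ENNReal.ofReal C₂ + ENNReal.ofReal C₁ * ENNReal.ofReal c₃⁻¹ := by
    rw [← ENNReal.ofReal_mul hC₁, ← ENNReal.ofReal_add hC₂ hC₂,
      ← ENNReal.ofReal_add (by positivity) (by positivity)]
    rfl
  rw [hc, add_mul, add_mul, mul_assoc]
  gcongr
  · exact lintegral_deriv_step_mul_le hf hδ.2 hτ.1 hτδ hs1
  · exact lintegral_ball_le_nevanlinnaNorm hs0 ⟨hs4, hs1⟩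

/-! ### Finite partial sums, trivial exponents and the conclusion -/

/-- The zero sum is controlled as soon as every finite partial sum is. -/
lemma blaschkeSum_le {w : ℂ → ℝ} {f : ℂ → ℂ} {B : ℝ≥0∞}
    (h : ∀ S : Finset ℂ, (∀ a ∈ S, ‖a‖ < 1 ∧ f a = 0) →
      ∑ a ∈ S, (analyticOrderNatAt f a : ℝ≥0∞) * ENNReal.ofReal ((1 - ‖a‖ ^ 2) * w a) ≤ B) :
    blaschkeSum w f ≤ B := by
  classical
  rw [blaschkeSum, ENNReal.tsum_eq_iSup_sum]
  refine iSup_le fun T => ?_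
  have := h (T.map (Function.Embedding.subtype _)) (by
    intro a ha
    obtain ⟨b, _, rfl⟩ := Finset.mem_map.1 ha
    exact ⟨by simpa using b.2.1, b.2.2⟩)
  rwa [Finset.sum_map] at this

lemma sum_order_mul_ofReal_le {f : ℂ → ℂ} {S : Finset ℂ} {v w : ℂ → ℝ} {K : ℝ} (hK : 0 < K)
    (h : ∀ a ∈ S, v a ≤ K * w a) (hw : ∀ a ∈ S, 0 ≤ w a) {κ : ℝ} (hκ : 0 < κ) {B : ℝ≥0∞}
    (hB : ENNReal.ofReal (κ * ∑ a ∈ S, (analyticOrderNatAt f a : ℝ) * w a) ≤ B) :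
    ∑ a ∈ S, (analyticOrderNatAt f a : ℝ≥0∞) * ENNReal.ofReal (v a) ≤
      ENNReal.ofReal (K / κ) * B := by
  have h1 : ∑ a ∈ S, (analyticOrderNatAt f a : ℝ≥0∞) * ENNReal.ofReal (v a) ≤
      ENNReal.ofReal (K / κ * (κ * ∑ a ∈ S, (analyticOrderNatAt f a : ℝ) * w a)) := by
    rw [← mul_assoc, div_mul_cancel₀ _ hκ.ne', Finset.mul_sum, ENNReal.ofReal_sum_of_nonneg]
    · refine Finset.sum_le_sum fun a ha => ?_
      rw [← ENNReal.ofReal_natCast, ← ENNReal.ofReal_mul (Nat.cast_nonneg _)]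
      refine ENNReal.ofReal_le_ofReal ?_
      rw [mul_left_comm]
      exact mul_le_mul_of_nonneg_left (h a ha) (Nat.cast_nonneg _)
    · exact fun a ha => mul_nonneg hK.le (mul_nonneg (Nat.cast_nonneg _) (hw a ha))
  refine h1.trans ?_
  rw [ENNReal.ofReal_mul (by positivity)]
  gcongr

/-- The case of trivial exponents: Jensen's formula on circles close to the boundary. -/
lemma sum_order_le_of_exponents_zero {η : Fin n → ℂ} {q : Fin n → ℝ} (hq : ∀ j, q j = 0)
    {f : ℂ → ℂ} (hf : DifferentiableOn ℂ f (ball 0 1)) (h0 : ‖f 0‖ = 1) {δ : ℝ}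
    (hδ : δ ∈ Set.Ioo (0 : ℝ) 1) {S : Finset ℂ} (hS : ∀ a ∈ S, ‖a‖ < 1 ∧ f a = 0) :
    ENNReal.ofReal (2 * Real.pi * ∑ a ∈ S, (analyticOrderNatAt f a : ℝ) * (1 - ‖a‖ ^ 2)) ≤
      4 * nevanlinnaNorm η q δ f := by
  have hev : ∀ᶠ s in nhdsWithin (1 : ℝ) (Set.Iio 1),
      (∀ a ∈ S, (1 - ‖a‖ ^ 2) / 4 ≤ Real.log (s / ‖a‖)) ∧ s ∈ Set.Ioo (1 - δ) 1 := by
    refine ((Filter.eventually_all_finset S).2 fun a ha => ?_).and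
      (Ioo_mem_nhdsLT (by linarith [hδ.1]))
    have ha0 : 0 < ‖a‖ := by
      rw [norm_pos_iff]
      rintro rfl
      rw [(hS 0 ha).2, norm_zero] at h0
      exact zero_ne_one h0
    -- From `log (1 / |a|) ≥ 1 - |a|`, with `4` in place of `2` to make the inequality strict with
    -- room, so that it persists for radii `s` slightly below `1`.
    have hlt : (1 - ‖a‖ ^ 2) / 4 < Real.log (1 / ‖a‖) := by
      have h1 := Real.log_le_sub_one_of_pos ha0
      rw [one_div, Real.log_inv]
      nlinarith [(hS a ha).1]
    have hc : ContinuousAt (fun s : ℝ => Real.log (s / ‖a‖)) 1 :=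
      (continuousAt_id.div_const _).log (div_pos one_pos ha0).ne'
    exact ((hc.eventually (lt_mem_nhds hlt)).filter_mono nhdsWithin_le_nhds).mono fun _ h => h.le
  obtain ⟨s, hsS, hs⟩ := hev.exists
  have hs0 : 0 < s := by linarith [hs.1, hδ.2]
  have hA := analyticOnNhd_closedBall hf (c := 0) (R := s) (by simpa using hs.2)
  have hf0 : f 0 ≠ 0 := by rw [← norm_pos_iff, h0]; exact one_pos
  have hJ := sum_order_mul_posLog_le hs0 hA hf0 S
  rw [h0, Real.log_one, sub_zero] at hJ
  have hci : CircleIntegrable (fun z => Real.log ‖f z‖) 0 s := by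
    apply MeromorphicOn.circleIntegrable_log_norm
    rw [abs_of_pos hs0]
    exact (hA.mono sphere_subset_closedBall).meromorphicOn
  have hcp : CircleIntegrable (fun z => Real.posLog ‖f z‖) 0 s :=
    (Real.continuous_posLog.comp_continuousOn
      (hA.continuousOn.mono sphere_subset_closedBall).norm).circleIntegrable hs0.le
  have hmono : Real.circleAverage (fun z => Real.log ‖f z‖) 0 s ≤
      Real.circleAverage (fun z => Real.posLog ‖f z‖) 0 s :=
    Real.circleAverage_mono hci hcp fun _ _ => le_max_right _ _
  have hsum : ∑ a ∈ S, (analyticOrderNatAt f a : ℝ) * (1 - ‖a‖ ^ 2) ≤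
      4 * Real.circleAverage (fun z => Real.posLog ‖f z‖) 0 s := by
    refine le_trans ?_ (mul_le_mul_of_nonneg_left (hJ.trans hmono) (by norm_num))
    rw [Finset.mul_sum]
    refine Finset.sum_le_sum fun a ha => ?_
    have h1 : (1 - ‖a‖ ^ 2) / 4 ≤ Real.posLog (s / ‖0 - a‖) := by
      rw [zero_sub, norm_neg]
      exact (hsS a ha).trans (le_max_right _ _)
    have h2 := mul_le_mul_of_nonneg_left h1 (Nat.cast_nonneg (α := ℝ) (analyticOrderNatAt f a))
    linarith
  have hint : 2 * Real.pi * ∑ a ∈ S, (analyticOrderNatAt f a : ℝ) * (1 - ‖a‖ ^ 2) ≤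
      4 * ∫ θ in Set.Ioc (0 : ℝ) (2 * Real.pi), Real.posLog ‖f (circleMap 0 s θ)‖ := by
    refine (mul_le_mul_of_nonneg_left hsum Real.two_pi_pos.le).trans (le_of_eq ?_)
    rw [Real.circleAverage, intervalIntegral.integral_of_le Real.two_pi_pos.le, smul_eq_mul]
    field_simp
  refine (ENNReal.ofReal_le_ofReal hint).trans ?_
  rw [ENNReal.ofReal_mul (by norm_num), ENNReal.ofReal_ofNat]
  gcongr
  refine (ofReal_integral_le_lintegral _).trans
    (le_trans (le_of_eq ?_) (lintegral_circle_le_nevanlinnaNorm hs))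
  simp [absR, hq]

end NevanlinnaDisc

theorem mainTheorem4 (n : ℕ) (η : Fin n → ℂ) (hη : ∀ j, ‖η j‖ = 1) (q : Fin n → ℝ) :
    ∃ c : ℝ≥0, 0 < c ∧ ∀ f : ℂ → ℂ, NevanlinnaDisc.MemNevanlinna η q f → ‖f 0‖ = 1 →
      ∀ δ ∈ Set.Ioo (0 : ℝ) 1, NevanlinnaDisc.nevanlinnaNorm η q δ f < ∞ →
        NevanlinnaDisc.blaschkeSum (NevanlinnaDisc.absR η (fun j => max (q j) 0)) f ≤
          c * NevanlinnaDisc.nevanlinnaNorm η q δ f := by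
  open NevanlinnaDisc in
  have hκ : 0 < Real.pi * Real.log 2 := mul_pos Real.pi_pos (Real.log_pos one_lt_two)
  by_cases hq : ∀ j, q j = 0
  · refine ⟨Real.toNNReal (1 / (2 * Real.pi)) * 4, by positivity, fun f hf h0 δ hδ _ => ?_⟩
    refine blaschkeSum_le fun S hS => ?_
    rw [ENNReal.coe_mul, mul_assoc]
    refine sum_order_mul_ofReal_le (w := fun a => 1 - ‖a‖ ^ 2) one_pos (fun a _ => ?_)
      (fun a ha => ?_) Real.two_pi_pos (sum_order_le_of_exponents_zero hq hf.1 h0 hδ hS)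
    · simp [absR, hq]
    · nlinarith [(hS a ha).1, norm_nonneg a]
  · push Not at hq
    obtain ⟨j₀, hj₀⟩ := hq
    obtain ⟨C, hC⟩ := exists_testFn_sum_le hη hj₀
    -- The `2` comes from comparing `1 - |a|²` with the test function and `π log 2` from the Green
    -- inequality; `C + 1` ensures positivity.
    refine ⟨Real.toNNReal (2 / (Real.pi * Real.log 2)) * (C + 1), ?_, fun f hf h0 δ hδ _ => ?_⟩
    · have : 0 < 2 / (Real.pi * Real.log 2) := by positivity
      have := Real.toNNReal_pos.2 this
      positivity
    refine blaschkeSum_le fun S hS => ?_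
    -- The scale `τ` may depend on the finite set and on `δ`, because `C` does not depend on `τ`.
    have hev : ∀ᶠ τ in nhdsWithin (0 : ℝ) (Set.Ioi 0), (∀ a ∈ S, 4 * τ ≤ 1 - ‖a‖ ^ 2) ∧
        (1 - δ) ^ 2 < 1 - 2 * τ ∧ τ ∈ Set.Ioo (0 : ℝ) 1 := by
      refine ((Filter.eventually_all_finset S).2 fun a ha => ?_).and
        (Filter.Eventually.and ?_ (Ioo_mem_nhdsGT one_pos))
      · have : 0 < (1 - ‖a‖ ^ 2) / 4 := by nlinarith [(hS a ha).1, norm_nonneg a]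
        filter_upwards [Ioo_mem_nhdsGT this] with τ hτ
        linarith [hτ.2]
      · have : 0 < (1 - (1 - δ) ^ 2) / 2 := by nlinarith [hδ.1, hδ.2]
        filter_upwards [Ioo_mem_nhdsGT this] with τ hτ
        linarith [hτ.2]
    obtain ⟨τ, hτS, hτδ, hτ⟩ := hev.exists
    rw [ENNReal.coe_mul, mul_assoc]
    refine sum_order_mul_ofReal_le two_pos (fun a ha => half_mul_absR_le_testFn ?_ hτ.1 (hS a ha).1
      (hτS a ha)) (fun a _ => testFn_nonneg hτ.1 a) hκ ((hC f hf.1 h0 δ hδ τ hτ hτδ S).trans ?_)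
    · exact add_nonneg two_pos.le (Finset.sum_nonneg fun _ _ => le_max_right _ _)
    · gcongr
      exact_mod_cast le_self_add
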